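/- Let $k$ be a field, let $B = k\langle x,y\rangle/(x^2,y^2,xyx,yxy)$, let $0\neq q\in k$, put $w = xy-qyx$ (a central element of $B$), and let $A = B/(w)$. Let $\nu$ be the $k$-algebra automorphism of $B$ with $\nu(x) = -q^{-1}x$ and $\nu(y) = -qy$; it satisfies $\nu(bw)=bw$ for all $b\in B$, and the induced automorphism of $A$ is also denoted $\nu$. Then $A\simeq k\langle x,y\rangle/(x^2,\,xy-qyx,\,y^2)$ as $k$-algebras, by an isomorphism fixing the generators $x,y$. Let $\mathscr F(B)$ be the category of finitely generated free left $B$-modules, $S_\nu\colon \mathscr F(B)\to\mathscr F(B)$, $F\mapsto {}_\nu F$, the twisting functor (the same abelian group with $b\cdot m=\nu(b)m$; identity on maps), and $\eta_w\colon 1\to S_\nu$ the natural transformation $\eta_F(m)=wm$. A factorization is a sequence $(M,N,f,g)\colon M\xrightarrow{f}N\xrightarrow{g}S_\nu M$ in $\mathscr F(B)$ with $g\circ f=\eta_M$ and $S_\nu f\circ g=\eta_N$; a morphism $(M_1,N_1,f_1,g_1)\to(M_2,N_2,f_2,g_2)$ is a pair $(\psi\colon M_1\to M_2,\ \phi\colon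 N_1\to N_2)$ commuting with the structure maps; $(\psi,\phi)$ and $(\psi',\phi')$ are homotopic if there are $s\colon N_1\to M_2$ and $t\colon S_\nu M_1\to N_2$ with $\psi-\psi'=s f_1+S_\nu^{-1}(g_2 t)$ and $\phi-\phi'=t g_1+f_2 s$. Let $\mathbf{HFact}(\mathscr F(B),S_\nu,\eta_w)$ be the category of factorizations and homotopy classes of morphisms, with suspension $\Sigma(M,N,f,g)=(N,S_\nu M,-g,-S_\nu f)$ and with distinguished triangles those isomorphic to a standard triangle $X\xrightarrow{[\theta]}Y\xrightarrow{[i_\theta]}C_\theta\xrightarrow{[\pi_\theta]}\Sigma X$. Here, for $\theta=(\psi,\phi)$, the mapping cone $C_\theta$ is $$N_1\oplus M_2\xrightarrow{\left(\begin{smallmatrix}-g_1&0\\ \phi&f_2\end{smallmatrix}\right)}S_\nu M_1\oplus N_2\xrightarrow{\left(\begin{smallmatrix}-S_\nu f_1&0\\ S_\nu\psi&g_2\end{smallmatrix}\right)}S_\nu N_1\oplus S_\nu M_2,$$ and $i_\theta$, $\pi_\theta$ are the canonical inclusion and projection. Let $\mathbf{K_{ac}}(\mathscr F(A))$ be the homotopy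 category of acyclic (that is, exact) cochain complexes of finitely generated free left $A$-modules, with its usual triangulated structure. Then reduction modulo $w$ induces a triangle functor $$T\colon\mathbf{HFact}(\mathscr F(B),S_\nu,\eta_w)\longrightarrow\mathbf{K_{ac}}(\mathscr F(A)),$$ that is, an additive functor with a natural isomorphism $T\Sigma\simeq T(-)[1]$ under which distinguished triangles go to distinguished triangles. It sends a factorization $(M,N,f,g)$ to the complex $$\cdots\to{}_{\nu^{n-1}}(N/wN)\xrightarrow{\bar g}{}_{\nu^n}(M/wM)\xrightarrow{\bar f}{}_{\nu^n}(N/wN)\xrightarrow{\bar g}{}_{\nu^{n+1}}(M/wM)\to\cdots$$ with $M/wM$ in degree zero, and the class of $(\psi,\phi)$ to the class of the chain map given by the reductions $\bar\psi$, $\bar\phi$. In particular all these complexes are acyclic complexes of finitely generated free $A$-modules. -/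

import Mathlib

open CategoryTheory CategoryTheory.Limits

universe u v

/-! ### Factorizations of a central element in a suspended additive category -/

namespace SuspendedCategory

variable {C : Type u} [Category.{v} C]

/-- A central element of `(C, S)`: a natural transformation `η : 1 ⟶ S` such that
`η_{S M} = S η_M` for all objects `M`. -/
structure CentralElement (S : C ⥤ C) where
  /-- the natural transformation -/
  η : 𝟭 C ⟶ S
  central : ∀ M : C, η.app (S.obj M) = S.map (η.app M)

/-- A `(C, S)`-factorization `M ⟶ N ⟶ S M` of the central element `E`: `g ∘ f = η_M` and
`S f ∘ g = η_N`. -/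
structure Factorization {S : C ⥤ C} (E : CentralElement S) where
  M : C
  N : C
  f : M ⟶ N
  g : N ⟶ S.obj M
  f_g : f ≫ g = E.η.app M
  g_Sf : g ≫ S.map f = E.η.app N

namespace Factorization

variable {S : C ⥤ C} {E : CentralElement S}

/-- Morphisms of factorizations: pairs `(ψ, φ)` making both squares commute. -/
@[ext]
structure Hom (X Y : Factorization E) where
  ψ : X.M ⟶ Y.M
  φ : X.N ⟶ Y.N
  comm_f : X.f ≫ φ = ψ ≫ Y.f
  comm_g : X.g ≫ S.map ψ = φ ≫ Y.g

/-- The category `Fact(C, S, η)`. -/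
instance : Category (Factorization E) where
  Hom := Hom
  id X := ⟨𝟙 _, 𝟙 _, by simp, by simp⟩
  comp a b := ⟨a.ψ ≫ b.ψ, a.φ ≫ b.φ, by rw [← Category.assoc, a.comm_f, Category.assoc, b.comm_f,
      Category.assoc], by
      rw [S.map_comp, ← Category.assoc, a.comm_g, Category.assoc, b.comm_g, Category.assoc]⟩
  id_comp a := by ext <;> exact Category.id_comp _
  comp_id a := by ext <;> exact Category.comp_id _
  assoc a b c := by ext <;> exact Category.assoc _ _ _

@[ext]
lemma hom_ext {X Y : Factorization E} {a b : X ⟶ Y} (h₁ : a.ψ = b.ψ) (h₂ : a.φ = b.φ) : a = b :=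
  Hom.ext h₁ h₂

@[simp] lemma id_ψ (X : Factorization E) : Hom.ψ (𝟙 X) = 𝟙 X.M := rfl
@[simp] lemma id_φ (X : Factorization E) : Hom.φ (𝟙 X) = 𝟙 X.N := rfl
@[simp] lemma comp_ψ {X Y Z : Factorization E} (a : X ⟶ Y) (b : Y ⟶ Z) :
    (a ≫ b).ψ = a.ψ ≫ b.ψ := rfl
@[simp] lemma comp_φ {X Y Z : Factorization E} (a : X ⟶ Y) (b : Y ⟶ Z) :
    (a ≫ b).φ = a.φ ≫ b.φ := rfl

variable [Preadditive C] [S.Additive]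

instance {X Y : Factorization E} : Add (X ⟶ Y) where
  add a b := ⟨a.ψ + b.ψ, a.φ + b.φ, by simp [a.comm_f, b.comm_f], by simp [a.comm_g, b.comm_g]⟩

instance {X Y : Factorization E} : Zero (X ⟶ Y) where
  zero := ⟨0, 0, by simp, by simp⟩

instance {X Y : Factorization E} : Neg (X ⟶ Y) where
  neg a := ⟨-a.ψ, -a.φ, by simp [a.comm_f], by simp [a.comm_g]⟩

@[simp] lemma add_ψ {X Y : Factorization E} (a b : X ⟶ Y) : (a + b).ψ = a.ψ + b.ψ := rfl
@[simp] lemma add_φ {X Y : Factorization E} (a b : X ⟶ Y) : (a + b).φ = a.φ + b.φ := rfl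
@[simp] lemma zero_ψ {X Y : Factorization E} : Hom.ψ (0 : X ⟶ Y) = 0 := rfl
@[simp] lemma zero_φ {X Y : Factorization E} : Hom.φ (0 : X ⟶ Y) = 0 := rfl
@[simp] lemma neg_ψ {X Y : Factorization E} (a : X ⟶ Y) : (-a).ψ = -a.ψ := rfl
@[simp] lemma neg_φ {X Y : Factorization E} (a : X ⟶ Y) : (-a).φ = -a.φ := rfl

instance {X Y : Factorization E} : AddCommGroup (X ⟶ Y) where
  add_assoc a b c := by ext <;> simp [add_assoc]
  zero_add a := by ext <;> simp
  add_zero a := by ext <;> simp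
  add_comm a b := by ext <;> simp [add_comm]
  neg_add_cancel a := by ext <;> simp
  nsmul := nsmulRec
  zsmul := zsmulRec

instance : Preadditive (Factorization E) where
  add_comp _ _ _ a b c := by ext <;> simp
  comp_add _ _ _ a b c := by ext <;> simp

variable (E) in
/-- Two morphisms `θ = (ψ, φ)` and `θ' = (ψ', φ')` are homotopic if there are `s : N₁ ⟶ M₂` and
`t : S M₁ ⟶ N₂` with `ψ - ψ' = s ∘ f₁ + S⁻¹ (g₂ ∘ t)` and `φ - φ' = t ∘ g₁ + f₂ ∘ s`. Here
`S⁻¹ : Hom(S M₁, S M₂) → Hom(M₁, M₂)` is the inverse of the bijection given by `S`. -/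
def Homotopic [S.IsEquivalence] : HomRel (Factorization E) := fun X Y θ θ' =>
  ∃ (s : X.N ⟶ Y.M) (t : S.obj X.M ⟶ Y.N),
    θ.ψ - θ'.ψ = X.f ≫ s + S.preimage (t ≫ Y.g) ∧ θ.φ - θ'.φ = X.g ≫ t + s ≫ Y.f

variable [S.IsEquivalence]

instance : Congruence (Homotopic E) where
  equivalence :=
    { refl := fun θ => ⟨0, 0, S.map_injective (by simp), by simp⟩
      symm := by
        rintro θ θ' ⟨s, t, h₁, h₂⟩
        refine ⟨-s, -t, ?_, ?_⟩
        · rw [← neg_sub, h₁]; exact S.map_injective (by simp [add_comm])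
        · rw [← neg_sub, h₂]; simp [add_comm]
      trans := by
        rintro θ θ' θ'' ⟨s, t, h₁, h₂⟩ ⟨s', t', h₁', h₂'⟩
        refine ⟨s + s', t + t', ?_, ?_⟩
        · rw [← sub_add_sub_cancel, h₁, h₁']; exact S.map_injective (by simp; abel)
        · rw [← sub_add_sub_cancel, h₂, h₂']; simp; abel }
  comp_left := by
    rintro X Y Z a θ θ' ⟨s, t, h₁, h₂⟩
    refine ⟨a.φ ≫ s, S.map a.ψ ≫ t, ?_, ?_⟩
    · rw [comp_ψ, comp_ψ, ← Preadditive.comp_sub, h₁, Preadditive.comp_add,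
        ← reassoc_of% a.comm_f]
      exact S.map_injective (by simp)
    · rw [comp_φ, comp_φ, ← Preadditive.comp_sub, h₂, Preadditive.comp_add,
        ← reassoc_of% a.comm_g, Category.assoc]
  comp_right := by
    rintro X Y Z θ θ' a ⟨s, t, h₁, h₂⟩
    refine ⟨s ≫ a.ψ, t ≫ a.φ, ?_, ?_⟩
    · rw [comp_ψ, comp_ψ, ← Preadditive.sub_comp, h₁, Preadditive.add_comp]
      exact S.map_injective (by simp [a.comm_g])
    · rw [comp_φ, comp_φ, ← Preadditive.sub_comp, h₂, Preadditive.add_comp]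
      simp [a.comm_f]

lemma Homotopic.add ⦃X Y : Factorization E⦄ (a₁ a₂ b₁ b₂ : X ⟶ Y) (ha : Homotopic E a₁ a₂)
    (hb : Homotopic E b₁ b₂) : Homotopic E (a₁ + b₁) (a₂ + b₂) := by
  obtain ⟨s, t, h₁, h₂⟩ := ha
  obtain ⟨s', t', h₁', h₂'⟩ := hb
  refine ⟨s + s', t + t', ?_, ?_⟩
  · rw [add_ψ, add_ψ, add_sub_add_comm, h₁, h₁']; exact S.map_injective (by simp; abel)
  · rw [add_φ, add_φ, add_sub_add_comm, h₂, h₂']; simp; abel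


variable (E) in
/-- The homotopy category `HFact(C, S, η)`. -/
abbrev HFact := CategoryTheory.Quotient (Homotopic E)

variable (E) in
/-- The functor `Fact(C, S, η) ⥤ HFact(C, S, η)`, `θ ↦ [θ]`. -/
abbrev toHFact : Factorization E ⥤ HFact E := CategoryTheory.Quotient.functor (Homotopic E)

instance : Preadditive (HFact E) := CategoryTheory.Quotient.preadditive _ Homotopic.add

variable (E) in
/-- The suspension `Σ (M, N, f, g) = (N, S M, -g, -S f)`, as a functor on `Fact(C, S, η)`. -/
@[simps]
def preSuspension : Factorization E ⥤ Factorization E where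
  obj X :=
    { M := X.N
      N := S.obj X.M
      f := -X.g
      g := -S.map X.f
      f_g := by simp [X.g_Sf]
      g_Sf := by rw [S.map_neg, Preadditive.neg_comp_neg, ← S.map_comp, X.f_g, E.central] }
  map {X Y} a :=
    { ψ := a.φ
      φ := S.map a.ψ
      comm_f := by
        change (-X.g) ≫ S.map a.ψ = a.φ ≫ (-Y.g)
        rw [Preadditive.neg_comp, Preadditive.comp_neg, a.comm_g]
      comm_g := by
        change (-S.map X.f) ≫ S.map a.φ = S.map a.ψ ≫ (-S.map Y.f)
        rw [Preadditive.neg_comp, Preadditive.comp_neg, ← S.map_comp, a.comm_f, S.map_comp] }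
  map_id X := by ext <;> simp
  map_comp a b := by ext <;> simp

variable (E) in
/-- The suspension functor `Σ` on `HFact(C, S, η)`. -/
def suspension : HFact E ⥤ HFact E :=
  CategoryTheory.Quotient.lift _ (preSuspension E ⋙ toHFact E) (by
    rintro X Y θ θ' ⟨s, t, h₁, h₂⟩
    refine CategoryTheory.Quotient.sound _ ⟨-t, -S.map s, ?_, ?_⟩
    · change θ.φ - θ'.φ = (-X.g) ≫ (-t) + S.preimage ((-S.map s) ≫ (-S.map Y.f))
      rw [h₂, Preadditive.neg_comp_neg, Preadditive.neg_comp_neg, ← S.map_comp, S.preimage_map]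
    · change S.map θ.ψ - S.map θ'.ψ = (-S.map X.f) ≫ (-S.map s) + (-t) ≫ (-Y.g)
      rw [← S.map_sub, h₁, Preadditive.neg_comp_neg, Preadditive.neg_comp_neg, S.map_add,
        S.map_comp, S.map_preimage])

section Cone

variable [HasBinaryBiproducts C] {X Y : Factorization E} (θ : X ⟶ Y)

/-- The mapping cone `N₁ ⊕ M₂ ⟶ S M₁ ⊕ N₂ ⟶ S (N₁ ⊕ M₂) = S N₁ ⊕ S M₂` of `θ = (ψ, φ)`, with
matrices `(-g₁, 0; φ, f₂)` and `(-S f₁, 0; S ψ, g₂)`. -/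
@[simps]
noncomputable def cone : Factorization E where
  M := X.N ⊞ Y.M
  N := S.obj X.M ⊞ Y.N
  f := biprod.desc (-X.g ≫ biprod.inl + θ.φ ≫ biprod.inr) (Y.f ≫ biprod.inr)
  g := biprod.desc (-S.map X.f ≫ S.map biprod.inl + S.map θ.ψ ≫ S.map biprod.inr)
    (Y.g ≫ S.map biprod.inr)
  f_g := by
    apply biprod.hom_ext'
    · have h := E.η.naturality (biprod.inl : X.N ⟶ X.N ⊞ Y.M)
      have hc := θ.comm_g
      dsimp at h
      rw [h, ← X.g_Sf]
      simp [← reassoc_of% hc]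
    · have h := E.η.naturality (biprod.inr : Y.M ⟶ X.N ⊞ Y.M)
      dsimp at h
      rw [h, ← Y.f_g]
      simp
  g_Sf := by
    have h₁ : S.map (biprod.inl : X.N ⟶ X.N ⊞ Y.M) ≫ S.map (biprod.desc
        (-X.g ≫ biprod.inl + θ.φ ≫ biprod.inr) (Y.f ≫ biprod.inr)) =
        S.map (-X.g ≫ biprod.inl + θ.φ ≫ biprod.inr : X.N ⟶ S.obj X.M ⊞ Y.N) := by
      rw [← S.map_comp, biprod.inl_desc]
    have h₂ : S.map (biprod.inr : Y.M ⟶ X.N ⊞ Y.M) ≫ S.map (biprod.desc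
        (-X.g ≫ biprod.inl + θ.φ ≫ biprod.inr) (Y.f ≫ biprod.inr)) =
        S.map (Y.f ≫ biprod.inr : Y.M ⟶ S.obj X.M ⊞ Y.N) := by
      rw [← S.map_comp, biprod.inr_desc]
    apply biprod.hom_ext'
    · have h := E.η.naturality (biprod.inl : S.obj X.M ⟶ S.obj X.M ⊞ Y.N)
      have hc := congr_arg S.map θ.comm_f
      have hX := congr_arg S.map X.f_g
      dsimp at h
      rw [h, E.central, ← hX, biprod.inl_desc_assoc, Preadditive.add_comp, Preadditive.neg_comp,
        Category.assoc, Category.assoc, h₁, h₂]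
      simp only [S.map_comp] at hc
      simp [reassoc_of% hc]
    · have h := E.η.naturality (biprod.inr : Y.N ⟶ S.obj X.M ⊞ Y.N)
      dsimp at h
      rw [h, ← Y.g_Sf, biprod.inr_desc_assoc, Category.assoc, h₂]
      simp

/-- The morphism `i_θ` from the target of `θ` to the cone. -/
@[simps]
noncomputable def coneInr : Y ⟶ cone θ where
  ψ := biprod.inr
  φ := biprod.inr
  comm_f := by exact (biprod.inr_desc _ _).symm
  comm_g := by exact (biprod.inr_desc _ _).symm

/-- The morphism `π_θ` from the cone to the suspension of the source of `θ`. -/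
@[simps]
noncomputable def coneFst : cone θ ⟶ (preSuspension E).obj X where
  ψ := biprod.fst
  φ := biprod.fst
  comm_f := by
    change biprod.desc (-X.g ≫ biprod.inl + θ.φ ≫ biprod.inr) (Y.f ≫ biprod.inr) ≫ biprod.fst =
      (biprod.fst : X.N ⊞ Y.M ⟶ _) ≫ (-X.g)
    apply biprod.hom_ext' <;> simp
  comm_g := by
    change biprod.desc (-S.map X.f ≫ S.map biprod.inl + S.map θ.ψ ≫ S.map biprod.inr)
      (Y.g ≫ S.map biprod.inr) ≫ S.map (biprod.fst : X.N ⊞ Y.M ⟶ _) =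
      (biprod.fst : S.obj X.M ⊞ Y.N ⟶ _) ≫ (-S.map X.f)
    apply biprod.hom_ext'
    · simp only [biprod.inl_desc_assoc, Preadditive.add_comp, Preadditive.neg_comp,
        Category.assoc, ← S.map_comp, biprod.inl_fst, biprod.inr_fst, biprod.inl_fst_assoc]
      simp
    · simp only [biprod.inr_desc_assoc, Category.assoc, ← S.map_comp, biprod.inr_fst,
        biprod.inr_fst_assoc]
      simp

/-- The morphism `[π_θ]` of `HFact(C, S, η)`. -/
noncomputable def coneπ : (toHFact E).obj (cone θ) ⟶ (suspension E).obj ((toHFact E).obj X) :=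
  (toHFact E).map (coneFst θ)

end Cone

/-- The distinguished triangles `X ⟶ Y ⟶ Z ⟶ Σ X` of `HFact(C, S, η)`: those isomorphic to a
standard triangle `X₀ ⟶ Y₀ ⟶ C_θ ⟶ Σ X₀` with morphisms `[θ]`, `[i_θ]`, `[π_θ]`. -/
def IsDistinguished [HasBinaryBiproducts C] {X Y Z : HFact E} (a : X ⟶ Y) (b : Y ⟶ Z)
    (c : Z ⟶ (suspension E).obj X) : Prop :=
  ∃ (X₀ Y₀ : Factorization E) (θ : X₀ ⟶ Y₀) (e₁ : X ≅ (toHFact E).obj X₀)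
    (e₂ : Y ≅ (toHFact E).obj Y₀) (e₃ : Z ≅ (toHFact E).obj (cone θ)),
    a ≫ e₂.hom = e₁.hom ≫ (toHFact E).map θ ∧
    b ≫ e₃.hom = e₂.hom ≫ (toHFact E).map (coneInr θ) ∧
    c ≫ (suspension E).map e₁.hom = e₃.hom ≫ coneπ θ

/-- A triangle functor from `(HFact(C, S, η), Σ)` to a (pre)triangulated category `D`: an additive
functor `T` together with a natural isomorphism `T Σ ≅ T(-)[1]` such that every distinguished
triangle is sent to a distinguished triangle. -/
structure TriangleFunctor (E : CentralElement S) [HasBinaryBiproducts C] (D : Type*) [Category* D]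
    [Preadditive D] [HasZeroObject D] [HasShift D ℤ] [∀ n : ℤ, (shiftFunctor D n).Additive]
    [Pretriangulated D] where
  /-- the underlying functor -/
  T : HFact E ⥤ D
  additive : T.Additive
  /-- compatibility with the suspensions -/
  suspensionIso : suspension E ⋙ T ≅ T ⋙ shiftFunctor D (1 : ℤ)
  map_distinguished : ∀ {X Y Z : HFact E} (a : X ⟶ Y) (b : Y ⟶ Z)
    (c : Z ⟶ (suspension E).obj X), IsDistinguished a b c →
    Pretriangulated.Triangle.mk (T.map a) (T.map b) (T.map c ≫ suspensionIso.hom.app X) ∈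
      Pretriangulated.distinguishedTriangles (C := D)

end Factorization

end SuspendedCategory

/-! ### Finitely generated free modules and twists -/

section Modules

/-- The finitely generated free left modules over `R`. -/
def fgFree (R : Type u) [Ring R] : ObjectProperty (ModuleCat.{u} R) :=
  fun M => Module.Free R M ∧ Module.Finite R M

/-- The category `𝓕(R)` of finitely generated free left `R`-modules. -/
abbrev FGFree (R : Type u) [Ring R] := (fgFree R).FullSubcategory

instance (R : Type u) [Ring R] : (fgFree R).ContainsZero where
  exists_zero := ⟨ModuleCat.of R PUnit.{u + 1}, ModuleCat.isZero_of_subsingleton _,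
    ⟨inferInstanceAs (Module.Free R PUnit.{u + 1}), inferInstanceAs (Module.Finite R PUnit.{u + 1})⟩⟩

instance (R : Type u) [Ring R] : (fgFree R).IsClosedUnderIsomorphisms where
  of_iso e h := by
    have := h.1
    have := h.2
    exact ⟨Module.Free.of_equiv e.toLinearEquiv, Module.Finite.equiv e.toLinearEquiv⟩

instance (R : Type u) [Ring R] : HasBinaryBiproducts (FGFree R) where
  has_binary_biproduct X Y := by
    have := X.2.1
    have := X.2.2
    have := Y.2.1
    have := Y.2.2
    let Z : FGFree R := ⟨ModuleCat.of R (X.1 × Y.1), inferInstanceAs (Module.Free R (X.1 × Y.1)),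
      inferInstanceAs (Module.Finite R (X.1 × Y.1))⟩
    exact HasBinaryBiproduct.mk
      { bicone :=
          { pt := Z
            fst := ⟨ModuleCat.ofHom (LinearMap.fst R X.1 Y.1)⟩
            snd := ⟨ModuleCat.ofHom (LinearMap.snd R X.1 Y.1)⟩
            inl := ⟨ModuleCat.ofHom (LinearMap.inl R X.1 Y.1)⟩
            inr := ⟨ModuleCat.ofHom (LinearMap.inr R X.1 Y.1)⟩
            inl_fst := by ext; rfl
            inl_snd := by ext; rfl
            inr_fst := by ext; rfl
            inr_snd := by ext; rfl }
        isBilimit := isBinaryBilimitOfTotal _ (by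
          apply ObjectProperty.hom_ext
          apply ModuleCat.hom_ext
          exact LinearMap.ext fun z : X.1 × Y.1 => Prod.ext (add_zero z.1) (zero_add z.2)) }

variable {R : Type u} [Ring R]

/-- The twisted module `_σ M`: the abelian group `M` with `r • m = σ(r) m`. -/
def Twist (_ : RingAut R) (M : Type v) : Type v := M

namespace Twist

variable (σ : RingAut R) (M : Type v) [AddCommGroup M]

instance : AddCommGroup (Twist σ M) := inferInstanceAs (AddCommGroup M)

/-- The identity map `M → _σ M`. -/
def of : M ≃+ Twist σ M := AddEquiv.refl M

variable [Module R M]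

instance : Module R (Twist σ M) := Module.compHom M (σ : R →+* R)

lemma smul_of (r : R) (m : M) : r • of σ M m = of σ M (σ r • m) := rfl

end Twist

/-- The map `Twist.of`, as a semilinear equivalence. -/
def Twist.ofₛₗ (σ : RingAut R) (M : Type v) [AddCommGroup M] [Module R M] :
    letI := RingHomInvPair.of_ringEquiv σ
    letI := RingHomInvPair.of_ringEquiv_symm σ
    Twist σ M ≃ₛₗ[(σ : R →+* R)] M :=
  letI := RingHomInvPair.of_ringEquiv σ
  letI := RingHomInvPair.of_ringEquiv_symm σ
  { (Twist.of σ M).symm with map_smul' := fun _ _ => rfl }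

lemma fgFree_twist (σ : RingAut R) {M : ModuleCat.{u} R} (h : fgFree R M) :
    fgFree R (ModuleCat.of R (Twist σ M)) := by
  have := RingHomInvPair.of_ringEquiv σ
  have := RingHomInvPair.of_ringEquiv_symm σ
  have := h.1
  have := h.2
  exact ⟨Module.Free.of_equiv (Twist.ofₛₗ σ M).symm,
    Module.Finite.of_surjective (Twist.ofₛₗ σ M).symm.toLinearMap (Twist.ofₛₗ σ M).symm.surjective⟩

/-- An additive bijection compatible with the actions of `R` is an isomorphism in `𝓕(R)`. -/
def FGFree.isoMk {M N : FGFree R} (e : M.obj ≃+ N.obj) (h : ∀ (r : R) (m : M.obj),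
    e (r • m) = r • e m) : M ≅ N :=
  ObjectProperty.isoMk _ (LinearEquiv.toModuleIso { e with map_smul' := h })

/-- The twisting functor `S_σ : 𝓕(R) ⥤ 𝓕(R)`, `M ↦ _σ M`, the identity on maps. -/
def twist (σ : RingAut R) : FGFree R ⥤ FGFree R where
  obj M := ⟨ModuleCat.of R (Twist σ M.obj), fgFree_twist σ M.property⟩
  map {M N} f := ⟨ModuleCat.ofHom
    { toFun := fun m => Twist.of σ N.obj (f.hom ((Twist.of σ M.obj).symm m))
      map_add' := fun a b => by simp
      map_smul' := fun r m => map_smul f.hom.hom (σ r) ((Twist.of σ M.obj).symm m) }⟩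

instance (σ : RingAut R) : (twist σ).Additive where

/-- `S_1 = 1` (the identity on underlying abelian groups). -/
def twistOne : twist (1 : RingAut R) ≅ 𝟭 (FGFree R) :=
  NatIso.ofComponents (fun M => FGFree.isoMk (M := (twist 1).obj M) (N := M)
    (Twist.of (1 : RingAut R) M.obj).symm (fun _ _ => rfl)) (fun f => by ext; rfl)

/-- `S_σ S_τ = S_{τ σ}` (the identity on underlying abelian groups). -/
def twistMul (σ τ ρ : RingAut R) (h : ρ = τ * σ) : twist τ ⋙ twist σ ≅ twist ρ :=
  NatIso.ofComponents (fun M => FGFree.isoMk (M := (twist σ).obj ((twist τ).obj M))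
    (N := (twist ρ).obj M) (((Twist.of σ (Twist τ M.obj)).symm.trans
      (Twist.of τ M.obj).symm).trans (Twist.of ρ M.obj)) (fun _ _ => by subst h; rfl))
    (fun f => by ext; rfl)

/-- The twisting functor is an automorphism, with inverse the twisting functor of the inverse. -/
instance (σ : RingAut R) : (twist σ).IsEquivalence :=
  (CategoryTheory.Equivalence.mk (twist σ) (twist σ⁻¹)
    ((twistMul σ⁻¹ σ 1 (mul_inv_cancel σ).symm).trans twistOne).symm
    ((twistMul σ σ⁻¹ 1 (inv_mul_cancel σ).symm).trans twistOne)).isEquivalence_functor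

end Modules

/-! ### Twisted matrix factorizations and reduction -/

open SuspendedCategory

/-- A ring `B` with a central element `w` and an automorphism `ν` which fixes the elements of the
ideal `(w)`. -/
structure TwistData (B : Type u) [Ring B] where
  w : B
  w_central : ∀ b : B, b * w = w * b
  ν : RingAut B
  ν_mul_w : ∀ b : B, ν (b * w) = b * w

namespace TwistData

variable {B : Type u} [Ring B] (D : TwistData B)

lemma ν_w : D.ν D.w = D.w := by simpa using D.ν_mul_w 1

/-- The ideal `(w)`; it is two-sided since `w` is central. -/
abbrev ideal : Ideal B := Ideal.span {D.w}

instance : D.ideal.IsTwoSided := by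
  refine ⟨fun {a} b ha => ?_⟩
  obtain ⟨c, rfl⟩ := Ideal.mem_span_singleton'.1 ha
  rw [mul_assoc, ← D.w_central, ← mul_assoc]
  exact Ideal.mul_mem_left _ _ (Ideal.mem_span_singleton_self _)

/-- The factor ring `A = B/(w)`. -/
abbrev A : Type u := B ⧸ D.ideal

/-- The automorphism of `A = B/(w)` induced by `ν`. -/
def νA : RingAut D.A :=
  Ideal.quotientEquiv D.ideal D.ideal D.ν (by
    rw [Ideal.map_span, Set.image_singleton]
    simp [ν_w])

@[simp] lemma νA_mk (b : B) :
    D.νA (Ideal.Quotient.mk D.ideal b) = Ideal.Quotient.mk D.ideal (D.ν b) := rfl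

/-- The central element `η_w` of `(𝓕(B), S_ν)`, with coordinates `F ⟶ _ν F`, `m ↦ w m`. -/
def ηw : CentralElement (twist D.ν) where
  η :=
    { app := fun F => ⟨ModuleCat.ofHom
        { toFun := fun m => Twist.of D.ν F.obj (D.w • m)
          map_add' := fun a b => by simp
          map_smul' := fun b m => by
            change D.w • (b • m) = D.ν b • (D.w • m)
            rw [smul_smul, smul_smul, ← D.w_central, ← D.ν_mul_w b, map_mul, D.ν_w] }⟩
      naturality := fun F G f => by
        ext m
        exact (map_smul f.hom.hom D.w m).symm }
  central F := by
    ext m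
    change D.ν D.w • (show F.obj from m) = D.w • (show F.obj from m)
    rw [D.ν_w]

lemma mem_ideal_smul_top {F : Type v} [AddCommGroup F] [Module B F] (m : F) :
    m ∈ (D.ideal • ⊤ : Submodule B F) ↔ ∃ n : F, D.w • n = m := by
  constructor
  · intro h
    refine Submodule.smul_induction_on h ?_ ?_
    · intro r hr n _
      obtain ⟨c, rfl⟩ := Ideal.mem_span_singleton'.1 hr
      exact ⟨c • n, by rw [smul_smul, D.w_central]⟩
    · rintro _ _ ⟨a, rfl⟩ ⟨b, rfl⟩
      exact ⟨a + b, smul_add _ _ _⟩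
  · rintro ⟨n, rfl⟩
    exact Submodule.smul_mem_smul (Ideal.mem_span_singleton_self _) trivial

/-- The module `F/wF` over `A = B/(w)`. -/
def Red (F : Type v) [AddCommGroup F] [Module B F] : Type v :=
  F ⧸ (D.ideal • ⊤ : Submodule B F)

namespace Red

variable {F G : Type v} [AddCommGroup F] [Module B F] [AddCommGroup G] [Module B G]

instance : AddCommGroup (D.Red F) :=
  inferInstanceAs (AddCommGroup (F ⧸ (D.ideal • ⊤ : Submodule B F)))

instance : Module D.A (D.Red F) :=
  inferInstanceAs (Module (B ⧸ D.ideal) (F ⧸ (D.ideal • ⊤ : Submodule B F)))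

/-- The projection `F → F/wF`, linear along `B → A`. -/
def mk : F →ₛₗ[Ideal.Quotient.mk D.ideal] D.Red F where
  toFun m := Submodule.Quotient.mk (p := (D.ideal • ⊤ : Submodule B F)) m
  map_add' _ _ := rfl
  map_smul' _ _ := rfl

lemma mk_surjective : Function.Surjective (mk D (F := F)) := Submodule.Quotient.mk_surjective _

variable {D} in
lemma mk_eq_zero {m : F} : mk D m = 0 ↔ ∃ n : F, D.w • n = m :=
  (Submodule.Quotient.mk_eq_zero (D.ideal • ⊤ : Submodule B F)).trans (D.mem_ideal_smul_top m)

/-- An additive map `φ : F → P` which vanishes on `wF` induces a map on `F/wF`. -/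
def lift {P : Type*} [AddCommGroup P] (φ : F →+ P) (h : ∀ n, φ (D.w • n) = 0) : D.Red F →+ P :=
  QuotientAddGroup.lift (D.ideal • ⊤ : Submodule B F).toAddSubgroup φ (by
    intro m hm
    obtain ⟨n, rfl⟩ := (D.mem_ideal_smul_top m).1 hm
    exact h n)

@[simp] lemma lift_mk {P : Type*} [AddCommGroup P] (φ : F →+ P) (h : ∀ n, φ (D.w • n) = 0)
    (m : F) : lift D φ h (mk D m) = φ m := rfl

/-- The map `F/wF → G/wG` induced by a `B`-linear map `F → G`. -/
def map (f : F →ₗ[B] G) : D.Red F →ₗ[D.A] D.Red G where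
  toFun := lift D ((mk D).toAddMonoidHom.comp f.toAddMonoidHom) (fun n =>
    mk_eq_zero.2 ⟨f n, (map_smul f D.w n).symm⟩)
  map_add' := map_add _
  map_smul' a m := by
    obtain ⟨b, rfl⟩ := Ideal.Quotient.mk_surjective a
    obtain ⟨m, rfl⟩ := mk_surjective D m
    change mk D (f (b • m)) = Ideal.Quotient.mk D.ideal b • mk D (f m)
    rw [map_smul, map_smulₛₗ]

@[simp] lemma map_mk (f : F →ₗ[B] G) (m : F) : map D f (mk D m) = mk D (f m) := rfl

lemma free [Module.Free B F] : Module.Free D.A (D.Red F) := by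
  let b := Module.Free.chooseBasis B F
  let ι := Module.Free.ChooseBasisIndex B F
  let ψ : F →ₛₗ[Ideal.Quotient.mk D.ideal] (ι →₀ D.A) :=
    { toFun := fun m => Finsupp.mapRange (Ideal.Quotient.mk D.ideal) (map_zero _) (b.repr m)
      map_add' := fun _ _ => by ext; simp
      map_smul' := fun _ _ => by ext; simp }
  let φ : D.Red F →ₗ[D.A] (ι →₀ D.A) :=
    { toFun := lift D ψ.toAddMonoidHom (fun n => by
        ext i
        simp [ψ, Ideal.Quotient.eq_zero_iff_mem.2 (Ideal.mem_span_singleton_self D.w)])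
      map_add' := map_add _
      map_smul' := by
        intro a m
        obtain ⟨c, rfl⟩ := Ideal.Quotient.mk_surjective a
        obtain ⟨m, rfl⟩ := mk_surjective D m
        change ψ (c • m) = Ideal.Quotient.mk D.ideal c • ψ m
        rw [map_smulₛₗ] }
  have hφ (i : ι) : φ (mk D (b i)) = Finsupp.single i 1 := by
    change ψ (b i) = _
    simp [ψ]
  let χ : (ι →₀ D.A) →ₗ[D.A] D.Red F := Finsupp.linearCombination D.A (fun i => mk D (b i))
  have h₁ : φ ∘ₗ χ = LinearMap.id := by
    refine Finsupp.lhom_ext fun i a => ?_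
    rw [LinearMap.comp_apply, Finsupp.linearCombination_single, map_smul, hφ, LinearMap.id_apply,
      Finsupp.smul_single, smul_eq_mul, mul_one]
  have h₂ : χ ∘ₗ φ = LinearMap.id := by
    have h : (χ ∘ₗ φ).comp (mk D (F := F)) = mk D := b.ext fun i => by
      rw [LinearMap.comp_apply, LinearMap.comp_apply, hφ, Finsupp.linearCombination_single,
        one_smul]
    refine LinearMap.ext fun m => ?_
    obtain ⟨m, rfl⟩ := mk_surjective D m
    exact LinearMap.congr_fun h m
  exact Module.Free.of_basis (Module.Basis.ofRepr (LinearEquiv.ofLinearMap φ χ h₁ h₂))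

lemma finite [Module.Finite B F] : Module.Finite D.A (D.Red F) :=
  Module.Finite.of_surjective (mk D (F := F)) (mk_surjective D)

end Red

/-- Reduction modulo `w`, as a functor `𝓕(B) ⥤ 𝓕(A)`, `F ↦ F/wF`. -/
def reduce : FGFree B ⥤ FGFree D.A where
  obj F := ⟨ModuleCat.of D.A (D.Red F.obj),
    have := F.2.1
    have := F.2.2
    ⟨Red.free D, Red.finite D⟩⟩
  map f := ⟨ModuleCat.ofHom (Red.map D f.hom.hom)⟩
  map_id F := by
    ext m
    obtain ⟨m, rfl⟩ := Red.mk_surjective D m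
    rfl
  map_comp f g := by
    ext m
    obtain ⟨m, rfl⟩ := Red.mk_surjective D m
    rfl

instance : D.reduce.Additive where
  map_add {F G f g} := by
    ext m
    obtain ⟨m, rfl⟩ := Red.mk_surjective D m
    rfl

/-- `(_ν F)/w(_ν F) = _ν (F/wF)` (the identity on classes). -/
def reduceTwist : twist D.ν ⋙ D.reduce ≅ D.reduce ⋙ twist D.νA :=
  NatIso.ofComponents (fun F => FGFree.isoMk (M := D.reduce.obj ((twist D.ν).obj F))
    (N := (twist D.νA).obj (D.reduce.obj F))
    { toFun := Red.lift D ((Twist.of D.νA (D.Red F.obj)).toAddMonoidHom.comp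
        ((Red.mk D).toAddMonoidHom.comp (Twist.of D.ν F.obj).symm.toAddMonoidHom)) (by
          intro n
          exact Red.mk_eq_zero.2 ⟨(Twist.of D.ν F.obj).symm n,
            congrArg (· • (Twist.of D.ν F.obj).symm n) D.ν_w.symm⟩)
      invFun := fun m => Red.lift D ((Red.mk D).toAddMonoidHom.comp
        (Twist.of D.ν F.obj).toAddMonoidHom) (by
          intro n
          refine Red.mk_eq_zero.2 ⟨Twist.of D.ν F.obj n, congrArg (· • n) D.ν_w⟩)
        ((Twist.of D.νA (D.Red F.obj)).symm m)
      left_inv := by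
        intro m
        obtain ⟨m, rfl⟩ := Red.mk_surjective D m
        rfl
      right_inv := by
        intro m
        obtain ⟨m, rfl⟩ := (Twist.of D.νA (D.Red F.obj)).surjective m
        obtain ⟨m, rfl⟩ := Red.mk_surjective D m
        rfl
      map_add' := map_add _ } (by
        intro a m
        obtain ⟨b, rfl⟩ := Ideal.Quotient.mk_surjective a
        obtain ⟨m, rfl⟩ := Red.mk_surjective D m
        rfl)) (by
      intro F G f
      ext m
      obtain ⟨m, rfl⟩ := Red.mk_surjective D m
      rfl)

/-- The composite `𝓕(B) ⥤ 𝓕(A)`-image of `η_w` is zero, as `w` vanishes on `F/wF`. -/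
lemma reduce_η (F : FGFree B) : D.reduce.map (D.ηw.η.app F) = 0 := by
  ext m
  obtain ⟨m, rfl⟩ := Red.mk_surjective D m
  refine Red.mk_eq_zero.2 ⟨Twist.of D.ν F.obj m, ?_⟩
  exact congrArg (· • m) D.ν_w

/-- Positions in the periodic sequence: `(n, false)` is the position of `ν^n (M/wM)` and
`(n, true)` the position of `ν^n (N/wN)`. -/
def next : ℤ × Bool → ℤ × Bool
  | (n, false) => (n, true)
  | (n, true) => (n + 1, false)

/-- Degree `2n` is the position `(n, false)` and degree `2n + 1` the position `(n, true)`. -/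
def pos (i : ℤ) : ℤ × Bool := (i / 2, decide (i % 2 = 1))

lemma pos_succ (i : ℤ) : pos (i + 1) = next (pos i) := by
  rcases Int.emod_two_eq_zero_or_one i with h | h
  · have h₁ : (i + 1) / 2 = i / 2 := by omega
    have h₂ : (i + 1) % 2 = 1 := by omega
    simp [pos, next, h, h₁, h₂]
  · have h₁ : (i + 1) / 2 = i / 2 + 1 := by omega
    have h₂ : (i + 1) % 2 = 0 := by omega
    simp [pos, next, h, h₁, h₂]

/-- The modules `ν^n (M/wM)` and `ν^n (N/wN)`. -/
def term (X : Factorization D.ηw) : ℤ × Bool → FGFree D.A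
  | (n, false) => (twist (D.νA ^ n)).obj (D.reduce.obj X.M)
  | (n, true) => (twist (D.νA ^ n)).obj (D.reduce.obj X.N)

/-- The map `ν^n (M/wM) ⟶ ν^n (N/wN)` induced by `f`. -/
def fBar (X : Factorization D.ηw) (n : ℤ) : (twist (D.νA ^ n)).obj (D.reduce.obj X.M) ⟶
    (twist (D.νA ^ n)).obj (D.reduce.obj X.N) :=
  (twist (D.νA ^ n)).map (D.reduce.map X.f)

/-- The map `ν^n (N/wN) ⟶ ν^n (ν (M/wM)) = ν^(n+1) (M/wM)` induced by `g`. -/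
def gBar (X : Factorization D.ηw) (n : ℤ) : (twist (D.νA ^ n)).obj (D.reduce.obj X.N) ⟶
    (twist (D.νA ^ (n + 1))).obj (D.reduce.obj X.M) :=
  (twist (D.νA ^ n)).map (D.reduce.map X.g) ≫
    (twist (D.νA ^ n)).map (D.reduceTwist.hom.app X.M) ≫
      (twistMul (D.νA ^ n) D.νA (D.νA ^ (n + 1)) (by rw [add_comm, zpow_one_add])).hom.app
        (D.reduce.obj X.M)

lemma fBar_apply (X : Factorization D.ηw) (n : ℤ) (m : X.M.obj) :
    (D.fBar X n).hom (Twist.of (D.νA ^ n) _ (Red.mk D m)) =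
      Twist.of (D.νA ^ n) (D.Red X.N.obj) (Red.mk D (X.f.hom m)) := rfl

lemma gBar_apply (X : Factorization D.ηw) (n : ℤ) (m : X.N.obj) :
    (D.gBar X n).hom (Twist.of (D.νA ^ n) _ (Red.mk D m)) =
      Twist.of (D.νA ^ (n + 1)) (D.Red X.M.obj)
        (Red.mk D ((Twist.of D.ν X.M.obj).symm (X.g.hom m))) := rfl

/-- The differentials of the periodic sequence. -/
def diff (X : Factorization D.ηw) : ∀ p : ℤ × Bool, D.term X p ⟶ D.term X (next p)
  | (n, false) => D.fBar X n
  | (n, true) => D.gBar X n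

/-- The maps induced by a morphism of factorizations. -/
def termMap {X Y : Factorization D.ηw} (θ : X ⟶ Y) : ∀ p : ℤ × Bool, D.term X p ⟶ D.term Y p
  | (n, false) => (twist (D.νA ^ n)).map (D.reduce.map θ.ψ)
  | (n, true) => (twist (D.νA ^ n)).map (D.reduce.map θ.φ)

lemma diff_diff (X : Factorization D.ηw) (p : ℤ × Bool) :
    D.diff X p ≫ D.diff X (next p) = 0 := by
  obtain ⟨n, _ | _⟩ := p
  · change D.fBar X n ≫ D.gBar X n = 0
    ext m
    obtain ⟨m, rfl⟩ := (Twist.of (D.νA ^ n) _).surjective m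
    obtain ⟨m, rfl⟩ := Red.mk_surjective D m
    exact Red.mk_eq_zero.2 ⟨m, (congrArg (fun h => h.hom m) X.f_g).symm⟩
  · change D.gBar X n ≫ D.fBar X (n + 1) = 0
    ext m
    obtain ⟨m, rfl⟩ := (Twist.of (D.νA ^ n) _).surjective m
    obtain ⟨m, rfl⟩ := Red.mk_surjective D m
    exact Red.mk_eq_zero.2 ⟨m, (congrArg (fun h => h.hom m) X.g_Sf).symm⟩

lemma diff_termMap {X Y : Factorization D.ηw} (θ : X ⟶ Y) (p : ℤ × Bool) :
    D.diff X p ≫ D.termMap θ (next p) = D.termMap θ p ≫ D.diff Y p := by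
  obtain ⟨n, _ | _⟩ := p
  · change D.fBar X n ≫ (twist (D.νA ^ n)).map (D.reduce.map θ.φ) =
      (twist (D.νA ^ n)).map (D.reduce.map θ.ψ) ≫ D.fBar Y n
    ext m
    obtain ⟨m, rfl⟩ := (Twist.of (D.νA ^ n) _).surjective m
    obtain ⟨m, rfl⟩ := Red.mk_surjective D m
    exact congrArg (fun h => Red.mk D (h.hom m)) θ.comm_f
  · change D.gBar X n ≫ (twist (D.νA ^ (n + 1))).map (D.reduce.map θ.ψ) =
      (twist (D.νA ^ n)).map (D.reduce.map θ.φ) ≫ D.gBar Y n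
    ext m
    obtain ⟨m, rfl⟩ := (Twist.of (D.νA ^ n) _).surjective m
    obtain ⟨m, rfl⟩ := Red.mk_surjective D m
    exact congrArg (fun h => Red.mk D ((Twist.of D.ν Y.M.obj).symm (h.hom m))) θ.comm_g

/-- The complex
`⋯ ⟶ ν^(n-1) (N/wN) ⟶ ν^n (M/wM) ⟶ ν^n (N/wN) ⟶ ν^(n+1) (M/wM) ⟶ ⋯`
of finitely generated free `A`-modules, with `M/wM` in degree zero. -/
def complex (X : Factorization D.ηw) : CochainComplex (FGFree D.A) ℤ :=
  CochainComplex.of (fun i => D.term X (pos i))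
    (fun i => D.diff X (pos i) ≫ eqToHom (congrArg (D.term X) (pos_succ i).symm)) (fun i => by
      have h (p : ℤ × Bool) (hp : p = next (pos i)) : D.diff X (pos i) ≫
          eqToHom (congrArg (D.term X) hp.symm) ≫ D.diff X p = 0 := by
        subst hp
        simp [diff_diff]
      rw [Category.assoc, reassoc_of% (h _ (pos_succ i)), zero_comp])

lemma complex_d (X : Factorization D.ηw) (i : ℤ) : (D.complex X).d i (i + 1) =
    D.diff X (pos i) ≫ eqToHom (congrArg (D.term X) (pos_succ i).symm) :=
  CochainComplex.of_d (fun i => D.term X (pos i))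
    (fun i => D.diff X (pos i) ≫ eqToHom (congrArg (D.term X) (pos_succ i).symm)) i

/-- Reduction modulo `w` of factorizations, as a functor to complexes over `𝓕(A)`. -/
def reduceComplex : Factorization D.ηw ⥤ CochainComplex (FGFree D.A) ℤ where
  obj X := D.complex X
  map {X Y} θ := CochainComplex.ofHom (X := D.complex X) (Y := D.complex Y)
    (fun i => D.termMap θ (pos i)) (fun i => by
      have h (p : ℤ × Bool) (hp : p = next (pos i)) :
          eqToHom (congrArg (D.term X) hp.symm) ≫ D.termMap θ p =
            D.termMap θ (next (pos i)) ≫ eqToHom (congrArg (D.term Y) hp.symm) := by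
        subst hp
        simp
      rw [complex_d, complex_d]
      change D.termMap θ (pos i) ≫ D.diff Y (pos i) ≫ eqToHom _ =
        (D.diff X (pos i) ≫ eqToHom _) ≫ D.termMap θ (pos (i + 1))
      rw [Category.assoc, h _ (pos_succ i), reassoc_of% (D.diff_termMap θ (pos i))])
  map_id X := by
    ext i : 1
    change D.termMap (𝟙 X) (pos i) = 𝟙 (D.term X (pos i))
    obtain ⟨n, _ | _⟩ := pos i
    · change (twist (D.νA ^ n)).map (D.reduce.map (𝟙 X.M)) = 𝟙 _
      rw [CategoryTheory.Functor.map_id, CategoryTheory.Functor.map_id]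
    · change (twist (D.νA ^ n)).map (D.reduce.map (𝟙 X.N)) = 𝟙 _
      rw [CategoryTheory.Functor.map_id, CategoryTheory.Functor.map_id]
  map_comp {X Y Z} a b := by
    ext i : 1
    change D.termMap (a ≫ b) (pos i) = D.termMap a (pos i) ≫ D.termMap b (pos i)
    obtain ⟨n, _ | _⟩ := pos i
    · change (twist (D.νA ^ n)).map (D.reduce.map (a.ψ ≫ b.ψ)) = _
      rw [Functor.map_comp, Functor.map_comp]; rfl
    · change (twist (D.νA ^ n)).map (D.reduce.map (a.φ ≫ b.φ)) = _
      rw [Functor.map_comp, Functor.map_comp]; rfl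

end TwistData

/-! ### The homotopy category of acyclic complexes of finitely generated free modules -/

section Kac

variable (R : Type u) [Ring R]

/-- The homotopy category `K(𝓕(R))` of complexes of finitely generated free left `R`-modules. -/
abbrev KFree := HomotopyCategory (FGFree R) (ComplexShape.up ℤ)

/-- The complexes of finitely generated free left `R`-modules which are acyclic, that is, exact as
complexes of `R`-modules. -/
abbrev acyclicFree : ObjectProperty (KFree R) :=
  (HomotopyCategory.subcategoryAcyclic (ModuleCat.{u} R)).inverseImage
    ((fgFree R).ι.mapHomotopyCategory (ComplexShape.up ℤ))

/-- The homotopy category `K_ac(𝓕(R))` of acyclic complexes of finitely generated free left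
`R`-modules, a triangulated subcategory of `K(𝓕(R))`. -/
abbrev Kac := (acyclicFree R).FullSubcategory

lemma acyclicFree_iff (K : CochainComplex (FGFree R) ℤ) :
    acyclicFree R ((HomotopyCategory.quotient _ _).obj K) ↔
      (((fgFree R).ι.mapHomologicalComplex (ComplexShape.up ℤ)).obj K).Acyclic :=
  HomotopyCategory.quotient_obj_mem_subcategoryAcyclic_iff_acyclic _

end Kac

/-! ### The algebras `A` and `B` -/

namespace QuantumCI

variable (k : Type u) [Field k]

/-- The free generator `x` of `k⟨x, y⟩`. -/
abbrev X : FreeAlgebra k (Fin 2) := FreeAlgebra.ι k 0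

/-- The free generator `y` of `k⟨x, y⟩`. -/
abbrev Y : FreeAlgebra k (Fin 2) := FreeAlgebra.ι k 1

/-- The relations `x² = y² = xyx = yxy = 0`. -/
inductive RelB : FreeAlgebra k (Fin 2) → FreeAlgebra k (Fin 2) → Prop
  | xx : RelB (X k * X k) 0
  | yy : RelB (Y k * Y k) 0
  | xyx : RelB (X k * Y k * X k) 0
  | yxy : RelB (Y k * X k * Y k) 0

/-- The algebra `B = k⟨x, y⟩ / (x², y², xyx, yxy)`. -/
abbrev B := RingQuot (RelB k)

/-- The generator `x` of `B`. -/
def x : B k := RingQuot.mkAlgHom k (RelB k) (X k)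

/-- The generator `y` of `B`. -/
def y : B k := RingQuot.mkAlgHom k (RelB k) (Y k)

lemma xx : x k * x k = 0 := by
  simpa [x] using RingQuot.mkAlgHom_rel k (RelB.xx (k := k))
lemma yy : y k * y k = 0 := by
  simpa [y] using RingQuot.mkAlgHom_rel k (RelB.yy (k := k))
lemma xyx : x k * y k * x k = 0 := by
  simpa [x, y] using RingQuot.mkAlgHom_rel k (RelB.xyx (k := k))
lemma yxy : y k * x k * y k = 0 := by
  simpa [x, y] using RingQuot.mkAlgHom_rel k (RelB.yxy (k := k))

variable {k}

/-- The algebra map `B → C` with `x ↦ a` and `y ↦ b`. -/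
def liftB {C : Type*} [Ring C] [Algebra k C] (a b : C) (haa : a * a = 0) (hbb : b * b = 0)
    (haba : a * b * a = 0) (hbab : b * a * b = 0) : B k →ₐ[k] C :=
  RingQuot.liftAlgHom k ⟨FreeAlgebra.lift k ![a, b], by
    rintro _ _ (_ | _ | _ | _) <;> simp [haa, hbb, haba, hbab]⟩

@[simp] lemma liftB_x {C : Type*} [Ring C] [Algebra k C] (a b : C) (haa : a * a = 0)
    (hbb : b * b = 0) (haba : a * b * a = 0) (hbab : b * a * b = 0) :
    liftB a b haa hbb haba hbab (x k) = a := by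
  simp [liftB, x]

@[simp] lemma liftB_y {C : Type*} [Ring C] [Algebra k C] (a b : C) (haa : a * a = 0)
    (hbb : b * b = 0) (haba : a * b * a = 0) (hbab : b * a * b = 0) :
    liftB a b haa hbb haba hbab (y k) = b := by
  simp [liftB, y]

lemma algHom_ext {C : Type*} [Ring C] [Algebra k C] {φ ψ : B k →ₐ[k] C} (hx : φ (x k) = ψ (x k))
    (hy : φ (y k) = ψ (y k)) : φ = ψ := by
  apply RingQuot.ringQuot_ext'
  apply FreeAlgebra.hom_ext
  funext i
  fin_cases i
  · exact hx
  · exact hy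

variable (q : k)

/-- The quantum commutator `w = xy - q yx` in `B`. -/
def w : B k := x k * y k - q • (y k * x k)

/-- The endomorphism of `B` with `x ↦ a x` and `y ↦ b y`, for scalars `a` and `b`. -/
def scale (a b : k) : B k →ₐ[k] B k :=
  liftB (a • x k) (b • y k) (by simp [xx]) (by simp [yy]) (by simp [xyx]) (by simp [yxy])

lemma scale_scale {a b a' b' : k} (ha : a * a' = 1) (hb : b * b' = 1) :
    (scale a b).comp (scale a' b') = AlgHom.id k (B k) :=
  algHom_ext (by simp [scale, smul_smul, mul_comm a', ha])
    (by simp [scale, smul_smul, mul_comm b', hb])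

variable {q}

/-- The automorphism `ν` of `B` with `ν(x) = -q⁻¹ x` and `ν(y) = -q y`. -/
def ν (hq : q ≠ 0) : B k ≃ₐ[k] B k :=
  AlgEquiv.ofAlgHom (scale (-q⁻¹) (-q)) (scale (-q) (-q⁻¹))
    (scale_scale (by simp [hq]) (by simp [hq])) (scale_scale (by simp [hq]) (by simp [hq]))

lemma ν_x (hq : q ≠ 0) : ν hq (x k) = -q⁻¹ • x k := by simp [ν, scale]
lemma ν_y (hq : q ≠ 0) : ν hq (y k) = -q • y k := by simp [ν, scale]

lemma x_w : x k * w q = 0 := by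
  simp [w, mul_sub, ← mul_assoc, xx, xyx]
lemma w_x : w q * x k = 0 := by
  rw [w, sub_mul, xyx, smul_mul_assoc, mul_assoc, xx, mul_zero, smul_zero, sub_zero]
lemma y_w : y k * w q = 0 := by
  simp [w, mul_sub, ← mul_assoc, yy, yxy]
lemma w_y : w q * y k = 0 := by
  rw [w, sub_mul, smul_mul_assoc, yxy, mul_assoc, yy, mul_zero, smul_zero, sub_zero]

variable (q) in
lemma exists_mul_w (b : B k) : ∃ c : k, b * w q = c • w q ∧ w q * b = c • w q := by
  obtain ⟨b, rfl⟩ := RingQuot.mkAlgHom_surjective k (RelB k) b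
  induction b using FreeAlgebra.induction with
  | grade0 c => exact ⟨c, by simp [Algebra.smul_def], by
      simp [Algebra.smul_def, Algebra.commutes]⟩
  | grade1 i =>
    refine ⟨0, ?_⟩
    rw [zero_smul]
    fin_cases i
    · exact ⟨x_w, w_x⟩
    · exact ⟨y_w, w_y⟩
  | mul a b ha hb =>
    obtain ⟨c, h₁, h₂⟩ := ha
    obtain ⟨d, h₃, h₄⟩ := hb
    refine ⟨c * d, ?_, ?_⟩
    · rw [map_mul, mul_assoc, h₃, mul_smul_comm, h₁, smul_smul, mul_comm]
    · rw [map_mul, ← mul_assoc, h₂, smul_mul_assoc, h₄, smul_smul]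
  | add a b ha hb =>
    obtain ⟨c, h₁, h₂⟩ := ha
    obtain ⟨d, h₃, h₄⟩ := hb
    refine ⟨c + d, ?_, ?_⟩
    · rw [map_add, add_mul, h₁, h₃, add_smul]
    · rw [map_add, mul_add, h₂, h₄, add_smul]

lemma ν_w (hq : q ≠ 0) : ν hq (w q) = w q := by
  simp [w, ν_x, ν_y, smul_smul, hq]

/-- The element `w = xy - q yx` and the automorphism `ν` of `B`. -/
def twistData (hq : q ≠ 0) : TwistData (B k) where
  w := w q
  w_central b := by
    obtain ⟨c, h₁, h₂⟩ := exists_mul_w q b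
    rw [h₁, h₂]
  ν := (ν hq).toRingEquiv
  ν_mul_w b := by
    obtain ⟨c, h, _⟩ := exists_mul_w q b
    rw [h]
    change ν hq (c • w q) = c • w q
    rw [map_smul, ν_w]

/-- The relations `x² = 0`, `xy - q yx = 0`, `y² = 0`. -/
inductive RelA (q : k) : FreeAlgebra k (Fin 2) → FreeAlgebra k (Fin 2) → Prop
  | xx : RelA q (X k * X k) 0
  | comm : RelA q (X k * Y k - q • (Y k * X k)) 0
  | yy : RelA q (Y k * Y k) 0

/-- The quantum complete intersection `k⟨x, y⟩ / (x², xy - q yx, y²)`. -/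
abbrev QCI (q : k) := RingQuot (RelA q)

end QuantumCI

/-!
Reduction modulo `w` turns a factorization `M ⟶ N ⟶ S_ν M` into a periodic sequence with
`d² = w = 0`. That it is a triangle functor into the acyclic complexes rests on two facts.

*Acyclicity* (`QuantumCI.exists_eq_add_w_smul`). The element `w` is a zero divisor of `B`, so the
usual argument for matrix factorizations does not apply. In place of regularity one uses the
annihilators of `x` and of `y` in a free `B`-module and the relation `xM ∩ yM = 0`, which are read
off from the basis `1, x, y, xy, yx` of `B`. Reduce first modulo the ideal `(x) = xB + yxB`, which
contains `w` and has `B/(x) = k[y]/(y²)`. Exactness there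
(`QuantumCI.exists_eq_add_of_map_mem`) follows by applying `g` twice: if `f m ∈ (x)N`,
comparing `g f m` with `w m = x(ym) - q y(xm)` shows that `m` is congruent to some `y b`
modulo `g(N) + (x)M`; then `y f(b) ∈ xN ∩ yN = 0`, and comparing `g f b` with `w b` shows that
`y b` lies in `g(N) + (x)M`. Exactness modulo `w` follows since an element of `(x)M` is congruent
to some `x c` modulo `w`, and the condition on `x f(c)` puts `f c` into `(x)N` again. This gives
exactness at `M`; exactness at `N` is exactness at `M` for the suspension.

*Triangles* (`TwistData.cone_distinguished`). The complex of `Σ X` is the shift of the complex of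
`X`, and the sequence `Y ⟶ C_θ ⟶ Σ X` reduces to a degreewise split sequence of complexes whose
connecting morphism is the shift of the reduction of `θ`. Hence the rotated triangle of the cone is
distinguished; the rotation contributes a sign, which is put into the isomorphism
`T Σ ≅ T(-)[1]`. No homotopy has to be constructed by hand: a difference of homotopic morphisms
factors through the inclusion `X ⟶ C_𝟙` into the cone of the identity
(`SuspendedCategory.Factorization.exists_coneInr_comp_eq`), which is sent to zero because the
first morphism of its triangle is an identity.
-/

namespace QuantumCI

variable {k : Type u} [Field k]

/-! ### The basis `1, x, y, xy, yx` of `B` -/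

lemma exists_eq_linearCombination (b : B k) : ∃ c₀ c₁ c₂ c₃ c₄ : k, b =
    algebraMap k _ c₀ + c₁ • x k + c₂ • y k + c₃ • (x k * y k) + c₄ • (y k * x k) := by
  obtain ⟨b, rfl⟩ := RingQuot.mkAlgHom_surjective k (RelB k) b
  induction b using FreeAlgebra.induction with
  | grade0 c => exact ⟨c, 0, 0, 0, 0, by simp⟩
  | grade1 i =>
    fin_cases i
    · exact ⟨0, 1, 0, 0, 0, by simp [x]⟩
    · exact ⟨0, 0, 1, 0, 0, by simp [y]⟩
  | mul a b ha hb =>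
    obtain ⟨a₀, a₁, a₂, a₃, a₄, ha⟩ := ha
    obtain ⟨b₀, b₁, b₂, b₃, b₄, hb⟩ := hb
    refine ⟨a₀ * b₀, a₀ * b₁ + a₁ * b₀, a₀ * b₂ + a₂ * b₀, a₀ * b₃ + a₁ * b₂ + a₃ * b₀,
      a₀ * b₄ + a₂ * b₁ + a₄ * b₀, ?_⟩
    have hxyx : x k * (y k * x k) = 0 := by rw [← mul_assoc, xyx]
    have hyxy : y k * (x k * y k) = 0 := by rw [← mul_assoc, yxy]
    have hxxy : x k * (x k * y k) = 0 := by rw [← mul_assoc, xx, zero_mul]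
    have hyyx : y k * (y k * x k) = 0 := by rw [← mul_assoc, yy, zero_mul]
    rw [map_mul, ha, hb]
    simp only [Algebra.algebraMap_eq_smul_one, mul_add, add_mul, smul_mul_smul_comm, one_mul,
      mul_one, xx, yy, mul_assoc, hxyx, hyxy, hxxy, hyyx, mul_zero, smul_zero]
    module
  | add a b ha hb =>
    obtain ⟨a₀, a₁, a₂, a₃, a₄, ha⟩ := ha
    obtain ⟨b₀, b₁, b₂, b₃, b₄, hb⟩ := hb
    refine ⟨a₀ + b₀, a₁ + b₁, a₂ + b₂, a₃ + b₃, a₄ + b₄, ?_⟩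
    rw [map_add, ha, hb, map_add]
    module

/-- Left multiplication on `B`, written in the coordinates of the basis `1, x, y, xy, yx`. -/
def regularRep : B k →ₐ[k] Module.End k (Fin 5 → k) :=
  liftB
    { toFun := fun v => ![0, v 0, 0, v 2, 0]
      map_add' := fun v v' => by ext i; fin_cases i <;> simp
      map_smul' := fun c v => by ext i; fin_cases i <;> simp }
    { toFun := fun v => ![0, 0, v 0, 0, v 1]
      map_add' := fun v v' => by ext i; fin_cases i <;> simp
      map_smul' := fun c v => by ext i; fin_cases i <;> simp }
    (by ext v i; fin_cases i <;> simp) (by ext v i; fin_cases i <;> simp)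
    (by ext v i; fin_cases i <;> simp) (by ext v i; fin_cases i <;> simp)

/-- The coordinates of an element of `B` in the basis `1, x, y, xy, yx`. -/
def coords : B k →ₗ[k] (Fin 5 → k) :=
  (LinearMap.applyₗ (![1, 0, 0, 0, 0] : Fin 5 → k)).comp regularRep.toLinearMap

lemma coords_linearCombination (c₀ c₁ c₂ c₃ c₄ : k) :
    coords (algebraMap k _ c₀ + c₁ • x k + c₂ • y k + c₃ • (x k * y k) + c₄ • (y k * x k)) =
      ![c₀, c₁, c₂, c₃, c₄] := by
  ext i
  fin_cases i <;> simp [coords, regularRep, Algebra.algebraMap_eq_smul_one]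

lemma x_mul_linearCombination (c₀ c₁ c₂ c₃ c₄ : k) :
    x k * (algebraMap k _ c₀ + c₁ • x k + c₂ • y k + c₃ • (x k * y k) + c₄ • (y k * x k)) =
      algebraMap k _ 0 + c₀ • x k + (0 : k) • y k + c₂ • (x k * y k) + (0 : k) • (y k * x k) := by
  have hxyx : x k * (y k * x k) = 0 := by rw [← mul_assoc, xyx]
  have hxxy : x k * (x k * y k) = 0 := by rw [← mul_assoc, xx, zero_mul]
  simp only [Algebra.algebraMap_eq_smul_one, mul_add, mul_smul_comm, mul_one, xx, hxyx, hxxy]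
  module

lemma y_mul_linearCombination (c₀ c₁ c₂ c₃ c₄ : k) :
    y k * (algebraMap k _ c₀ + c₁ • x k + c₂ • y k + c₃ • (x k * y k) + c₄ • (y k * x k)) =
      algebraMap k _ 0 + (0 : k) • x k + c₀ • y k + (0 : k) • (x k * y k) + c₁ • (y k * x k) := by
  have hyxy : y k * (x k * y k) = 0 := by rw [← mul_assoc, yxy]
  have hyyx : y k * (y k * x k) = 0 := by rw [← mul_assoc, yy, zero_mul]
  simp only [Algebra.algebraMap_eq_smul_one, mul_add, mul_smul_comm, mul_one, yy, hyxy, hyyx]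
  module

/-! ### Annihilators of `x` and `y` -/

/-- The right ideals `xB` and `yB` intersect in zero. -/
lemma x_mul_eq_zero_of_eq {a b : B k} (h : x k * a = y k * b) : x k * a = 0 := by
  obtain ⟨a₀, a₁, a₂, a₃, a₄, rfl⟩ := exists_eq_linearCombination a
  obtain ⟨b₀, b₁, b₂, b₃, b₄, rfl⟩ := exists_eq_linearCombination b
  rw [x_mul_linearCombination, y_mul_linearCombination] at h
  have h' := congrArg coords h
  rw [coords_linearCombination, coords_linearCombination] at h'
  have h₁ := congrFun h' 1
  have h₃ := congrFun h' 3
  simp at h₁ h₃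
  rw [x_mul_linearCombination]
  simp [h₁, h₃]

/-- The right annihilator of `x` in `B`. -/
lemma exists_of_x_mul_eq_zero {a : B k} (h : x k * a = 0) :
    ∃ c d : B k, a = x k * c + y k * (x k * d) := by
  obtain ⟨a₀, a₁, a₂, a₃, a₄, rfl⟩ := exists_eq_linearCombination a
  rw [x_mul_linearCombination] at h
  have h' := congrArg coords h
  rw [coords_linearCombination] at h'
  have h₀ := congrFun h' 1
  have h₂ := congrFun h' 3
  simp at h₀ h₂
  refine ⟨algebraMap k _ a₁ + a₃ • y k, algebraMap k _ a₄, ?_⟩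
  simp only [h₀, h₂, Algebra.algebraMap_eq_smul_one, mul_add, mul_smul_comm, mul_one]
  module

/-- The right annihilator of `y` in `B`. -/
lemma exists_of_y_mul_eq_zero {a : B k} (h : y k * a = 0) :
    ∃ c d : B k, a = y k * c + x k * (y k * d) := by
  obtain ⟨a₀, a₁, a₂, a₃, a₄, rfl⟩ := exists_eq_linearCombination a
  rw [y_mul_linearCombination] at h
  have h' := congrArg coords h
  rw [coords_linearCombination] at h'
  have h₀ := congrFun h' 2
  have h₁ := congrFun h' 4
  simp at h₀ h₁
  refine ⟨algebraMap k _ a₂ + a₄ • x k, algebraMap k _ a₃, ?_⟩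
  simp only [h₀, h₁, Algebra.algebraMap_eq_smul_one, mul_add, mul_smul_comm, mul_one]
  module

section Free

variable {F : Type v} [AddCommGroup F] [Module (B k) F] [Module.Free (B k) F]
  [Module.Finite (B k) F]

lemma x_smul_eq_zero_of_eq {a b : F} (h : x k • a = y k • b) : x k • a = 0 := by
  let e := (Module.Free.chooseBasis (B k) F).equivFun
  apply e.injective
  ext i
  have h' := congrFun (congrArg e h) i
  rw [map_smul, map_smul] at h'
  rw [map_smul, map_zero]
  exact x_mul_eq_zero_of_eq h'

lemma y_smul_eq_zero_of_eq {a b : F} (h : x k • a = y k • b) : y k • b = 0 :=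
  h ▸ x_smul_eq_zero_of_eq h

lemma exists_of_x_smul_eq_zero {a : F} (h : x k • a = 0) :
    ∃ c d : F, a = x k • c + y k • x k • d := by
  let e := (Module.Free.chooseBasis (B k) F).equivFun
  have h' (i) : ∃ c d : B k, e a i = x k * c + y k * (x k * d) :=
    exists_of_x_mul_eq_zero (by simpa using congrFun (congrArg e h) i)
  choose c d hcd using h'
  refine ⟨e.symm c, e.symm d, e.injective ?_⟩
  ext i
  simp [hcd]

lemma exists_of_y_smul_eq_zero {a : F} (h : y k • a = 0) :
    ∃ c d : F, a = y k • c + x k • y k • d := by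
  let e := (Module.Free.chooseBasis (B k) F).equivFun
  have h' (i) : ∃ c d : B k, e a i = y k * c + x k * (y k * d) :=
    exists_of_y_mul_eq_zero (by simpa using congrFun (congrArg e h) i)
  choose c d hcd using h'
  refine ⟨e.symm c, e.symm d, e.injective ?_⟩
  ext i
  simp [hcd]

end Free

variable {q : k} (hq : q ≠ 0)

/-! ### The factor algebra `B/(w)` -/

/-- The class of `x` in `k⟨x, y⟩/(x², xy - q yx, y²)`. -/
def QCI.x (q : k) : QCI q := RingQuot.mkAlgHom k (RelA q) (X k)

/-- The class of `y` in `k⟨x, y⟩/(x², xy - q yx, y²)`. -/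
def QCI.y (q : k) : QCI q := RingQuot.mkAlgHom k (RelA q) (Y k)

lemma QCI.xx (q : k) : QCI.x q * QCI.x q = 0 := by
  simpa [QCI.x] using RingQuot.mkAlgHom_rel k (RelA.xx (q := q))

lemma QCI.yy (q : k) : QCI.y q * QCI.y q = 0 := by
  simpa [QCI.y] using RingQuot.mkAlgHom_rel k (RelA.yy (q := q))

lemma QCI.comm (q : k) : QCI.x q * QCI.y q = q • (QCI.y q * QCI.x q) := by
  rw [← sub_eq_zero]
  simpa [QCI.x, QCI.y] using RingQuot.mkAlgHom_rel k (RelA.comm (q := q))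

/-- The canonical map `B → k⟨x, y⟩/(x², xy - q yx, y²)`. -/
def toQCI (q : k) : B k →ₐ[k] QCI q :=
  liftB (QCI.x q) (QCI.y q) (QCI.xx q) (QCI.yy q)
    (by rw [QCI.comm, smul_mul_assoc, mul_assoc, QCI.xx, mul_zero, smul_zero])
    (by rw [mul_assoc, QCI.comm, mul_smul_comm, ← mul_assoc, QCI.yy, zero_mul, smul_zero])

lemma toQCI_w (q : k) : toQCI q (w q) = 0 := by
  simp [w, toQCI, QCI.comm]

lemma toQCI_eq_zero {a : B k} (ha : a ∈ (twistData hq).ideal) : toQCI q a = 0 := by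
  obtain ⟨c, rfl⟩ := Ideal.mem_span_singleton'.1 ha
  rw [map_mul]
  exact (congrArg _ (toQCI_w q)).trans (mul_zero _)

/-- The canonical map `k⟨x, y⟩/(x², xy - q yx, y²) → B/(w)`. -/
def ofQCI : QCI q →ₐ[k] (twistData hq).A :=
  RingQuot.liftAlgHom k ⟨FreeAlgebra.lift k
    ![Ideal.Quotient.mkₐ k _ (x k), Ideal.Quotient.mkₐ k _ (y k)], by
      rintro _ _ (_ | _ | _)
      · simp only [map_mul, FreeAlgebra.lift_ι_apply, map_zero, Matrix.cons_val_zero]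
        rw [← map_mul, xx, map_zero]
      · simp only [map_mul, map_sub, map_smul, FreeAlgebra.lift_ι_apply, map_zero,
          Matrix.cons_val_zero, Matrix.cons_val_one]
        rw [← map_mul, ← map_mul, ← map_smul, ← map_sub]
        exact Ideal.Quotient.eq_zero_iff_mem.2 (Ideal.mem_span_singleton_self _)
      · simp only [map_mul, FreeAlgebra.lift_ι_apply, map_zero]
        change Ideal.Quotient.mkₐ k _ (y k) * Ideal.Quotient.mkₐ k _ (y k) = _
        rw [← map_mul, yy, map_zero]⟩

lemma ofQCI_x : ofQCI hq (QCI.x q) = Ideal.Quotient.mkₐ k _ (x k) := by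
  simp [ofQCI, QCI.x]

lemma ofQCI_y : ofQCI hq (QCI.y q) = Ideal.Quotient.mkₐ k _ (y k) := by
  simp [ofQCI, QCI.y]

/-- The isomorphism `B/(w) ≃ k⟨x, y⟩/(x², xy - q yx, y²)` fixing the generators. -/
def quotientEquivQCI : (twistData hq).A ≃ₐ[k] QCI q :=
  AlgEquiv.ofAlgHom (Ideal.Quotient.liftₐ (twistData hq).ideal (toQCI q)
      (fun _ ha => toQCI_eq_zero hq ha)) (ofQCI hq)
    (by
      apply RingQuot.ringQuot_ext'
      apply FreeAlgebra.hom_ext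
      funext i
      fin_cases i
      · change Ideal.Quotient.liftₐ _ _ (fun _ ha => toQCI_eq_zero hq ha)
          (ofQCI hq (QCI.x q)) = QCI.x q
        rw [ofQCI_x]
        exact liftB_x ..
      · change Ideal.Quotient.liftₐ _ _ (fun _ ha => toQCI_eq_zero hq ha)
          (ofQCI hq (QCI.y q)) = QCI.y q
        rw [ofQCI_y]
        exact liftB_y ..)
    (by
      apply Ideal.Quotient.algHom_ext
      apply algHom_ext
      · change ofQCI hq (toQCI q (x k)) = Ideal.Quotient.mk _ (x k)
        simp [toQCI, ofQCI_x]
      · change ofQCI hq (toQCI q (y k)) = Ideal.Quotient.mk _ (y k)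
        simp [toQCI, ofQCI_y])

lemma quotientEquivQCI_x :
    quotientEquivQCI hq (Ideal.Quotient.mk _ (x k)) = RingQuot.mkAlgHom k _ (X k) :=
  liftB_x ..

lemma quotientEquivQCI_y :
    quotientEquivQCI hq (Ideal.Quotient.mk _ (y k)) = RingQuot.mkAlgHom k _ (Y k) :=
  liftB_y ..

/-! ### Exactness of reduced factorizations over `B` -/

section Module

variable {M : Type v} [AddCommGroup M] [Module (B k) M]

lemma xx_smul (m : M) : x k • x k • m = 0 := by rw [smul_smul, xx, zero_smul]

lemma yy_smul (m : M) : y k • y k • m = 0 := by rw [smul_smul, yy, zero_smul]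

lemma xyx_smul (m : M) : x k • y k • x k • m = 0 := by
  rw [smul_smul, smul_smul, xyx, zero_smul]

/-- The scalar `-q` stands next to `m`, so that it can be absorbed into `m`. -/
lemma w_smul (m : M) :
    w q • m = x k • y k • m + y k • x k • algebraMap k (B k) (-q) • m := by
  rw [smul_smul, smul_smul, smul_smul, ← add_smul, ← Algebra.commutes, ← Algebra.smul_def, w,
    sub_eq_add_neg]
  exact congrArg (fun z => (x k * y k + z) • m) (neg_smul q (y k * x k)).symm

lemma smul_smul_of_mul_eq_one {c d : k} (h : c * d = 1) (m : M) :
    algebraMap k (B k) c • algebraMap k (B k) d • m = m := by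
  rw [smul_smul, ← map_mul, h, map_one, one_smul]

lemma smul_algebraMap_smul (b : B k) (c : k) (m : M) :
    b • algebraMap k (B k) c • m = algebraMap k (B k) c • b • m := by
  rw [smul_smul, smul_smul, Algebra.commutes]

/-- In a free module, the annihilator of `yx` is `xM + yM`. -/
lemma exists_of_yx_smul_eq_zero [Module.Free (B k) M] [Module.Finite (B k) M] {m : M}
    (h : y k • x k • m = 0) : ∃ a b : M, m = x k • a + y k • b := by
  obtain ⟨c, d, hcd⟩ := exists_of_y_smul_eq_zero h
  have h₁ : x k • (m - y k • d) = y k • c := by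
    rw [smul_sub, hcd]; abel
  obtain ⟨a, b, hab⟩ := exists_of_x_smul_eq_zero (x_smul_eq_zero_of_eq h₁)
  exact ⟨a, d + x k • b, by rw [smul_add, sub_eq_iff_eq_add.1 hab]; abel⟩

end Module

variable {M N : Type v} [AddCommGroup M] [Module (B k) M]
  [AddCommGroup N] [Module (B k) N]

section Semilinear

variable {g : N →+ M} (hg : ∀ b n, g (b • n) = ν hq b • g n)

include hg in
lemma map_x_smul (n : N) : g (x k • n) = x k • algebraMap k (B k) (-q⁻¹) • g n := by
  rw [hg, ν_x, smul_smul, ← Algebra.commutes, Algebra.smul_def]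

include hg in
lemma map_y_smul (n : N) : g (y k • n) = y k • algebraMap k (B k) (-q) • g n := by
  rw [hg, ν_y, smul_smul, ← Algebra.commutes, Algebra.smul_def]

include hg in
lemma map_algebraMap_smul (c : k) (n : N) :
    g (algebraMap k (B k) c • n) = algebraMap k (B k) c • g n := by
  rw [hg, AlgEquiv.commutes]

end Semilinear

variable [Module.Free (B k) M] [Module.Finite (B k) M] {f : M →ₗ[B k] N} {g : N →+ M}
  (hg : ∀ b n, g (b • n) = ν hq b • g n) (hgf : ∀ m, g (f m) = w q • m)

include hg hgf in
/-- If `f m` lies in `xN + yxN`, then `m` lies in `g(N) + xM + yM`: compare the two sides of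
`g (f m) = w m = x (y m) - q yx m`. -/
lemma exists_eq_add_of_map_eq {m : M} {u u' : N} (h : f m = x k • u + y k • x k • u') :
    ∃ a b : M, m = g (algebraMap k (B k) (-q⁻¹) • u') + x k • a + y k • b := by
  have hq₁ : -q⁻¹ * -q = 1 := by simp [hq]
  have hq₂ : -q * -q⁻¹ = 1 := by simp [hq]
  have h' := hgf m
  rw [h, w_smul, map_add, map_x_smul hq hg, map_y_smul hq hg, map_x_smul hq hg,
    ← smul_algebraMap_smul (x k), smul_smul_of_mul_eq_one hq₂] at h'
  have h₁ : x k • (y k • m - algebraMap k (B k) (-q⁻¹) • g u) =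
      y k • x k • (g u' - algebraMap k (B k) (-q) • m) := by
    rw [smul_sub, smul_sub, smul_sub, sub_eq_sub_iff_add_eq_add, ← h']
    abel
  obtain ⟨a, b, hab⟩ := exists_of_yx_smul_eq_zero (y_smul_eq_zero_of_eq h₁)
  refine ⟨algebraMap k (B k) q⁻¹ • a, algebraMap k (B k) q⁻¹ • b, ?_⟩
  have hm : m = algebraMap k (B k) (-q⁻¹) • g u' -
      algebraMap k (B k) (-q⁻¹) • (g u' - algebraMap k (B k) (-q) • m) := by
    rw [← smul_sub, sub_sub_cancel, smul_smul_of_mul_eq_one hq₁]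
  rw [hab, map_neg (algebraMap k (B k)), neg_smul _ (_ + _), sub_neg_eq_add, ← map_neg,
    smul_add, ← add_assoc] at hm
  rw [map_algebraMap_smul hq hg, smul_algebraMap_smul, smul_algebraMap_smul]
  exact hm

include hg hgf in
/-- If `f b` lies in the annihilator of `y`, then `y b` lies in `g(N) + xM + yxM`: compare the two
sides of `g (f b) = w b`. -/
lemma exists_y_smul_eq_add {b : M} {c d : N} (h : f b = y k • c + x k • y k • d) :
    ∃ (n : N) (e e' : M), y k • b = g n + x k • e + y k • x k • e' := by
  have hq₁ : -q⁻¹ * -q = 1 := by simp [hq]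
  have hq₂ : -q * -q⁻¹ = 1 := by simp [hq]
  have h' := hgf b
  rw [h, w_smul, map_add, map_y_smul hq hg, map_x_smul hq hg, map_y_smul hq hg,
    ← smul_algebraMap_smul (y k), smul_smul_of_mul_eq_one hq₁] at h'
  have h₁ : x k • y k • (b - g d) =
      y k • (algebraMap k (B k) (-q) • g c - x k • algebraMap k (B k) (-q) • b) := by
    rw [smul_sub, smul_sub, smul_sub, sub_eq_sub_iff_add_eq_add, ← h']
  obtain ⟨e, e', he⟩ := exists_of_x_smul_eq_zero (x_smul_eq_zero_of_eq h₁)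
  refine ⟨y k • algebraMap k (B k) (-q⁻¹) • d, e, e', ?_⟩
  rw [map_y_smul hq hg, map_algebraMap_smul hq hg, smul_smul_of_mul_eq_one hq₂, add_assoc, ← he,
    smul_sub]
  abel

variable [Module.Free (B k) N] [Module.Finite (B k) N] (hfg : ∀ n, f (g n) = w q • n)

include hg hgf hfg in
/-- Exactness modulo the ideal `(x)` of `B`: this ideal is `xB + yxB`, and it contains `w`. -/
lemma exists_eq_add_of_map_mem {m : M} {u u' : N} (h : f m = x k • u + y k • x k • u') :
    ∃ (n : N) (c d : M), m = g n + x k • c + y k • x k • d := by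
  have hq₂ : -q * -q⁻¹ = 1 := by simp [hq]
  -- Applying `g` to `h` reduces to the case of an element `y b`.
  obtain ⟨a, b, hab⟩ := exists_eq_add_of_map_eq hq hg hgf h
  have hb : x k • (u - y k • algebraMap k (B k) (-q⁻¹) • u' - f a) = y k • f b := by
    have h₁ := congrArg f hab
    rw [map_add, map_add, hfg, map_smul, map_smul, w_smul, h, smul_smul_of_mul_eq_one hq₂] at h₁
    rw [smul_sub, smul_sub, sub_sub, sub_eq_iff_eq_add]
    apply add_right_cancel (b := y k • x k • u')
    rw [h₁]
    abel
  -- In this case `f b` lies in `yN + xyN`, and `g` is applied once more.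
  obtain ⟨c, d, hcd⟩ := exists_of_y_smul_eq_zero (y_smul_eq_zero_of_eq hb)
  obtain ⟨n, e, e', he⟩ := exists_y_smul_eq_add hq hg hgf hcd
  refine ⟨algebraMap k (B k) (-q⁻¹) • u' + n, a + e, e', ?_⟩
  rw [hab, he, map_add, smul_add]
  abel

include hg hgf hfg in
/-- Exactness modulo the ideal `(w)` of `B`, deduced from exactness modulo the larger ideal
`(x)`. -/
lemma exists_eq_add_w_smul {m : M} {n₀ : N} (h : f m = w q • n₀) :
    ∃ (n : N) (e : M), m = g n + w q • e := by
  have hq₁ : -q⁻¹ * -q = 1 := by simp [hq]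
  have hq₂ : -q * -q⁻¹ = 1 := by simp [hq]
  rw [w_smul] at h
  obtain ⟨n, c, d, hm⟩ := exists_eq_add_of_map_mem hq hg hgf hfg h
  rw [← w_smul] at h
  -- Modulo `w`, the elements `yx` and `q⁻¹ xy` agree, so that `m` is congruent to `g n + x c'`.
  obtain ⟨c', d', hm⟩ : ∃ c' d', m = g n + x k • c' + w q • d' := by
    refine ⟨c - y k • algebraMap k (B k) (-q⁻¹) • d, algebraMap k (B k) (-q⁻¹) • d, ?_⟩
    rw [w_smul, smul_smul_of_mul_eq_one hq₂, smul_sub, hm]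
    abel
  -- The element `e := n₀ - n - f d'` satisfies `x f(c') = w e`; it follows that `e ∈ xN + yN`.
  obtain ⟨e, he⟩ : ∃ e, x k • f c' = w q • e := by
    refine ⟨n₀ - n - f d', ?_⟩
    rw [smul_sub, smul_sub, ← h, hm, map_add, map_add, hfg, map_smul, map_smul]
    abel
  have h₁ : x k • (f c' - y k • e) = y k • x k • algebraMap k (B k) (-q) • e := by
    rw [smul_sub, he, w_smul]
    abel
  obtain ⟨e₁, e₂, he'⟩ := exists_of_yx_smul_eq_zero (y_smul_eq_zero_of_eq h₁)
  obtain ⟨c₁, c₂, hc⟩ := exists_of_x_smul_eq_zero (x_smul_eq_zero_of_eq h₁)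
  have hye : y k • e = y k • x k • algebraMap k (B k) (-q⁻¹) • e₁ := by
    rw [← smul_smul_of_mul_eq_one hq₁ e, he', smul_add, smul_add, smul_algebraMap_smul (y k) _
      (y k • _), yy_smul, smul_zero, add_zero, smul_algebraMap_smul (x k)]
  have hfc : f c' = x k • c₁ + y k • x k • (c₂ + algebraMap k (B k) (-q⁻¹) • e₁) := by
    rw [sub_eq_iff_eq_add.1 hc, hye, smul_add, smul_add]
    abel
  -- Hence `c'` lies in `g(N) + xM + yxM`, and `x` annihilates `xM + yxM`.
  obtain ⟨n', a, b, hc'⟩ := exists_eq_add_of_map_mem hq hg hgf hfg hfc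
  refine ⟨n + x k • algebraMap k (B k) (-q) • n', d', ?_⟩
  rw [hm, hc', map_add, map_x_smul hq hg, map_algebraMap_smul hq hg,
    smul_smul_of_mul_eq_one hq₁, smul_add, smul_add, xx_smul, xyx_smul, add_zero, add_zero]

end QuantumCI

/-! ### Cones of factorizations -/

namespace SuspendedCategory.Factorization

variable {C : Type u} [Category.{v} C] {S : C ⥤ C} {E : CentralElement S} [Preadditive C]
  [S.Additive] [HasBinaryBiproducts C]

/-- The difference of homotopic morphisms `X ⟶ Y` extends along `X ⟶ C_𝟙` to the cone of the
identity: the homotopy provides the two missing matrix entries. -/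
lemma exists_coneInr_comp_eq [S.IsEquivalence] {X Y : Factorization E} {θ θ' : X ⟶ Y}
    (h : Homotopic E θ θ') :
    ∃ δ : cone (𝟙 X) ⟶ Y, coneInr (𝟙 X) ≫ δ = θ - θ' := by
  obtain ⟨s, t, h₁, h₂⟩ := h
  have hψ : (θ - θ').ψ = X.f ≫ s + S.preimage (t ≫ Y.g) := by
    rw [← h₁, sub_eq_add_neg, sub_eq_add_neg, add_ψ, neg_ψ]
  have hφ : (θ - θ').φ = X.g ≫ t + s ≫ Y.f := by
    rw [← h₂, sub_eq_add_neg, sub_eq_add_neg, add_φ, neg_φ]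
  let δ : cone (𝟙 X) ⟶ Y :=
    { ψ := biprod.desc s (θ - θ').ψ
      φ := biprod.desc t (θ - θ').φ
      comm_f := by
        change biprod.desc (-X.g ≫ biprod.inl + 𝟙 X.N ≫ biprod.inr) (X.f ≫ biprod.inr) ≫
          biprod.desc t (θ - θ').φ = (biprod.desc s (θ - θ').ψ : X.N ⊞ X.M ⟶ Y.M) ≫ Y.f
        apply biprod.hom_ext'
        · simp [hφ]
        · simp [(θ - θ').comm_f]
      comm_g := by
        change biprod.desc (-S.map X.f ≫ S.map biprod.inl + S.map (𝟙 X.M) ≫ S.map biprod.inr)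
          (X.g ≫ S.map biprod.inr) ≫ S.map (biprod.desc s (θ - θ').ψ : X.N ⊞ X.M ⟶ Y.M) =
            (biprod.desc t (θ - θ').φ : S.obj X.M ⊞ X.N ⟶ Y.N) ≫ Y.g
        apply biprod.hom_ext'
        · simp only [biprod.inl_desc_assoc, Preadditive.add_comp, Preadditive.neg_comp,
            Category.assoc, ← S.map_comp, biprod.inl_desc, biprod.inr_desc, hψ]
          simp
        · simp only [biprod.inr_desc_assoc, Category.assoc, ← S.map_comp, biprod.inr_desc]
          exact (θ - θ').comm_g }
  exact ⟨δ, by ext <;> exact biprod.inr_desc _ _⟩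

lemma inl_cone_f_snd {X Y : Factorization E} (θ : X ⟶ Y) :
    (biprod.inl : X.N ⟶ X.N ⊞ Y.M) ≫ (cone θ).f ≫ (biprod.snd : S.obj X.M ⊞ Y.N ⟶ Y.N) =
      θ.φ := by
  change (biprod.inl : X.N ⟶ X.N ⊞ Y.M) ≫
    biprod.desc (-X.g ≫ biprod.inl + θ.φ ≫ biprod.inr) (Y.f ≫ biprod.inr) ≫ biprod.snd = θ.φ
  simp

lemma inl_cone_g_snd {X Y : Factorization E} (θ : X ⟶ Y) :
    (biprod.inl : S.obj X.M ⟶ S.obj X.M ⊞ Y.N) ≫ (cone θ).g ≫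
      S.map (biprod.snd : X.N ⊞ Y.M ⟶ Y.M) = S.map θ.ψ := by
  change (biprod.inl : S.obj X.M ⟶ S.obj X.M ⊞ Y.N) ≫
    biprod.desc (-S.map X.f ≫ S.map biprod.inl + S.map θ.ψ ≫ S.map biprod.inr)
      (Y.g ≫ S.map biprod.inr) ≫ S.map (biprod.snd : X.N ⊞ Y.M ⟶ Y.M) = S.map θ.ψ
  simp only [biprod.inl_desc_assoc, Preadditive.add_comp, Preadditive.neg_comp, Category.assoc,
    ← S.map_comp, biprod.inl_snd, biprod.inr_snd]
  simp

end SuspendedCategory.Factorization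

/-! ### Terms of the reduced complex -/

namespace TwistData

variable {B : Type u} [Ring B] (D : TwistData B)

open Factorization Pretriangulated

/-- The maps induced by a pair of morphisms which need not commute with the structure maps. -/
def termHom {X Y : Factorization D.ηw} (ψ : X.M ⟶ Y.M) (φ : X.N ⟶ Y.N) :
    ∀ p : ℤ × Bool, D.term X p ⟶ D.term Y p
  | (n, false) => (twist (D.νA ^ n)).map (D.reduce.map ψ)
  | (n, true) => (twist (D.νA ^ n)).map (D.reduce.map φ)

lemma termMap_eq_termHom {X Y : Factorization D.ηw} (θ : X ⟶ Y) (p : ℤ × Bool) :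
    D.termMap θ p = D.termHom θ.ψ θ.φ p := by
  obtain ⟨n, _ | _⟩ := p <;> rfl

lemma termHom_id (X : Factorization D.ηw) (p : ℤ × Bool) :
    D.termHom (𝟙 X.M) (𝟙 X.N) p = 𝟙 (D.term X p) := by
  obtain ⟨n, _ | _⟩ := p <;> simp [termHom, term]

lemma termHom_comp {X Y Z : Factorization D.ηw} (ψ : X.M ⟶ Y.M) (φ : X.N ⟶ Y.N)
    (ψ' : Y.M ⟶ Z.M) (φ' : Y.N ⟶ Z.N) (p : ℤ × Bool) :
    D.termHom ψ φ p ≫ D.termHom ψ' φ' p = D.termHom (ψ ≫ ψ') (φ ≫ φ') p := by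
  obtain ⟨n, _ | _⟩ := p <;> exact ((D.reduce ⋙ twist (D.νA ^ n)).map_comp _ _).symm

lemma termHom_add {X Y : Factorization D.ηw} (ψ ψ' : X.M ⟶ Y.M) (φ φ' : X.N ⟶ Y.N)
    (p : ℤ × Bool) :
    D.termHom (ψ + ψ') (φ + φ') p = D.termHom ψ φ p + D.termHom ψ' φ' p := by
  obtain ⟨n, _ | _⟩ := p <;> exact (D.reduce ⋙ twist (D.νA ^ n)).map_add

instance : D.reduceComplex.Additive where
  map_add {X Y a b} := by
    ext i : 1
    change D.termMap (a + b) (pos i) = D.termMap a (pos i) + D.termMap b (pos i)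
    simp only [termMap_eq_termHom, add_ψ, add_φ, termHom_add]

/-- The terms of the complex of `Σ X` are the terms of the complex of `X`, one step further. -/
def termSuspension (X : Factorization D.ηw) :
    ∀ p : ℤ × Bool, D.term ((preSuspension D.ηw).obj X) p ≅ D.term X (next p)
  | (_, false) => Iso.refl _
  | (n, true) => (twist (D.νA ^ n)).mapIso (D.reduceTwist.app X.M) ≪≫
      (twistMul (D.νA ^ n) D.νA (D.νA ^ (n + 1)) (by rw [add_comm, zpow_one_add])).app
        (D.reduce.obj X.M)

lemma termSuspension_naturality {X Y : Factorization D.ηw} (θ : X ⟶ Y) (p : ℤ × Bool) :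
    D.termMap ((preSuspension D.ηw).map θ) p ≫ (D.termSuspension Y p).hom =
      (D.termSuspension X p).hom ≫ D.termMap θ (next p) := by
  obtain ⟨n, _ | _⟩ := p
  · exact (Category.comp_id _).trans (Category.id_comp _).symm
  · ext m
    obtain ⟨m, rfl⟩ := (Twist.of (D.νA ^ n) _).surjective m
    obtain ⟨m, rfl⟩ := Red.mk_surjective D m
    rfl

lemma diff_termSuspension (X : Factorization D.ηw) (p : ℤ × Bool) :
    D.diff ((preSuspension D.ηw).obj X) p ≫ (D.termSuspension X (next p)).hom =
      -(D.termSuspension X p).hom ≫ D.diff X (next p) := by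
  obtain ⟨n, _ | _⟩ := p
  · ext m
    obtain ⟨m, rfl⟩ := (Twist.of (D.νA ^ n) _).surjective m
    obtain ⟨m, rfl⟩ := Red.mk_surjective D m
    rfl
  · ext m
    obtain ⟨m, rfl⟩ := (Twist.of (D.νA ^ n) _).surjective m
    obtain ⟨m, rfl⟩ := Red.mk_surjective D m
    rfl

section Cone

variable {X Y : Factorization D.ηw} (θ : X ⟶ Y)

/-- The inclusion of the terms of `Σ X` into those of the cone of `θ`. -/
noncomputable def termInl (p : ℤ × Bool) :
    D.term ((preSuspension D.ηw).obj X) p ⟶ D.term (cone θ) p :=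
  D.termHom (X := (preSuspension D.ηw).obj X) (Y := cone θ) biprod.inl biprod.inl p

/-- The projection of the terms of the cone of `θ` onto those of `Y`. -/
noncomputable def termSnd (p : ℤ × Bool) : D.term (cone θ) p ⟶ D.term Y p :=
  D.termHom (X := cone θ) (Y := Y) biprod.snd biprod.snd p

lemma coneInr_termSnd (p : ℤ × Bool) :
    D.termMap (coneInr θ) p ≫ D.termSnd θ p = 𝟙 (D.term Y p) := by
  rw [termMap_eq_termHom, ← termHom_id]
  refine (D.termHom_comp ..).trans (congrArg₂ (fun a b => D.termHom a b p) ?_ ?_)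
  · exact biprod.inr_snd
  · exact biprod.inr_snd

lemma termInl_coneFst (p : ℤ × Bool) :
    D.termInl θ p ≫ D.termMap (coneFst θ) p = 𝟙 (D.term ((preSuspension D.ηw).obj X) p) := by
  rw [termMap_eq_termHom, ← termHom_id]
  refine (D.termHom_comp ..).trans (congrArg₂ (fun a b => D.termHom a b p) ?_ ?_)
  · exact biprod.inl_fst
  · exact biprod.inl_fst

lemma termSnd_coneInr_add (p : ℤ × Bool) :
    D.termSnd θ p ≫ D.termMap (coneInr θ) p + D.termMap (coneFst θ) p ≫ D.termInl θ p =
      𝟙 (D.term (cone θ) p) := by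
  rw [termMap_eq_termHom, termMap_eq_termHom, ← termHom_id]
  refine (congrArg₂ (· + ·) (D.termHom_comp ..) (D.termHom_comp ..)).trans
    ((D.termHom_add ..).symm.trans (congrArg₂ (fun a b => D.termHom a b p) ?_ ?_))
  · exact (add_comm _ _).trans biprod.total
  · exact (add_comm _ _).trans biprod.total

lemma coneInr_coneFst : coneInr θ ≫ coneFst θ = 0 :=
  Factorization.hom_ext biprod.inr_fst biprod.inr_fst

/-- The lower left entries of the matrices of the cone of `θ` are the entries of `θ`. -/
lemma termInl_diff_termSnd (p : ℤ × Bool) :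
    D.termInl θ p ≫ D.diff (cone θ) p ≫ D.termSnd θ (next p) =
      (D.termSuspension X p).hom ≫ D.termMap θ (next p) := by
  obtain ⟨n, _ | _⟩ := p
  · ext m
    obtain ⟨m, rfl⟩ := (Twist.of (D.νA ^ n) _).surjective m
    obtain ⟨m, rfl⟩ := Red.mk_surjective D m
    exact congrArg (fun h => Red.mk D (h.hom m)) (inl_cone_f_snd θ)
  · ext m
    obtain ⟨m, rfl⟩ := (Twist.of (D.νA ^ n) _).surjective m
    obtain ⟨m, rfl⟩ := Red.mk_surjective D m
    exact congrArg (fun h => Red.mk D ((Twist.of D.ν Y.M.obj).symm (h.hom m)))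
      (inl_cone_g_snd θ)

end Cone

/-! ### Suspensions and cones under reduction -/

-- The indices `pos (i + 1)` and `next (pos i)` agree only propositionally, and the following
-- lemmas move the resulting transports across the structure maps.

lemma eqToHom_termMap {X Y : Factorization D.ηw} (θ : X ⟶ Y) {p p' : ℤ × Bool} (h : p = p') :
    eqToHom (congrArg (D.term X) h) ≫ D.termMap θ p' =
      D.termMap θ p ≫ eqToHom (congrArg (D.term Y) h) := by
  subst h; simp

lemma eqToHom_termSnd {X Y : Factorization D.ηw} (θ : X ⟶ Y) {p p' : ℤ × Bool} (h : p = p') :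
    eqToHom (congrArg (D.term (cone θ)) h) ≫ D.termSnd θ p' =
      D.termSnd θ p ≫ eqToHom (congrArg (D.term Y) h) := by
  subst h; simp

lemma eqToHom_termSuspension (X : Factorization D.ηw) {p p' : ℤ × Bool} (h : p = p') :
    eqToHom (congrArg (D.term ((preSuspension D.ηw).obj X)) h) ≫ (D.termSuspension X p').hom =
      (D.termSuspension X p).hom ≫ eqToHom (congrArg (fun p => D.term X (next p)) h) := by
  subst h; simp

lemma eqToHom_diff (X : Factorization D.ηw) {p p' : ℤ × Bool} (h : p = p') :
    eqToHom (congrArg (D.term X) h) ≫ D.diff X p' =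
      D.diff X p ≫ eqToHom (congrArg (fun p => D.term X (next p)) h) := by
  subst h; simp

/-- The complex of `Σ X` is the complex of `X`, shifted by one. -/
def complexSuspension (X : Factorization D.ηw) :
    D.reduceComplex.obj ((preSuspension D.ηw).obj X) ≅
      (shiftFunctor (CochainComplex (FGFree D.A) ℤ) (1 : ℤ)).obj (D.reduceComplex.obj X) :=
  HomologicalComplex.Hom.isoOfComponents
    (fun i => D.termSuspension X (pos i) ≪≫ eqToIso (congrArg (D.term X) (pos_succ i).symm)) (by
      rintro i _ rfl
      have h : (((D.reduceComplex.obj X)⟦(1 : ℤ)⟧).d i (i + 1)) =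
          -(D.complex X).d (i + 1) (i + 1 + 1) := by
        simp [reduceComplex]
      rw [h, complex_d]
      change ((D.termSuspension X (pos i)).hom ≫ eqToHom (congrArg (D.term X) (pos_succ i).symm)) ≫
          (-(D.diff X (pos (i + 1)) ≫ eqToHom (congrArg (D.term X) (pos_succ (i + 1)).symm))) =
        (D.complex ((preSuspension D.ηw).obj X)).d i (i + 1) ≫
          (D.termSuspension X (pos (i + 1))).hom ≫
            eqToHom (congrArg (D.term X) (pos_succ (i + 1)).symm)
      rw [complex_d]
      change _ = (D.diff ((preSuspension D.ηw).obj X) (pos i) ≫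
        eqToHom (congrArg (D.term ((preSuspension D.ηw).obj X)) (pos_succ i).symm)) ≫ _ ≫ _
      rw [Category.assoc, Category.assoc, Preadditive.comp_neg, Preadditive.comp_neg,
        reassoc_of% (D.eqToHom_termSuspension X (pos_succ i).symm),
        reassoc_of% (D.diff_termSuspension X (pos i)),
        reassoc_of% (D.eqToHom_diff X (pos_succ i).symm)]
      simp)

/-- The natural isomorphism between reduction of the suspension and shift of the reduction. -/
def reduceComplexSuspension : preSuspension D.ηw ⋙ D.reduceComplex ≅
    D.reduceComplex ⋙ shiftFunctor (CochainComplex (FGFree D.A) ℤ) (1 : ℤ) :=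
  NatIso.ofComponents D.complexSuspension (fun {X Y} θ => by
    ext i : 1
    change D.termMap ((preSuspension D.ηw).map θ) (pos i) ≫
        (D.termSuspension Y (pos i)).hom ≫ eqToHom (congrArg (D.term Y) (pos_succ i).symm) =
      ((D.termSuspension X (pos i)).hom ≫ eqToHom (congrArg (D.term X) (pos_succ i).symm)) ≫
        D.termMap θ (pos (i + 1))
    rw [Category.assoc, D.eqToHom_termMap θ (pos_succ i).symm,
      reassoc_of% (D.termSuspension_naturality θ (pos i))])

/-- The sequence `Y ⟶ C_θ ⟶ Σ X`, reduced modulo `w`. -/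
@[simps]
noncomputable def coneShortComplex {X Y : Factorization D.ηw} (θ : X ⟶ Y) :
    ShortComplex (CochainComplex (FGFree D.A) ℤ) where
  X₁ := D.reduceComplex.obj Y
  X₂ := D.reduceComplex.obj (cone θ)
  X₃ := D.reduceComplex.obj ((preSuspension D.ηw).obj X)
  f := D.reduceComplex.map (coneInr θ)
  g := D.reduceComplex.map (coneFst θ)
  zero := by
    rw [← Functor.map_comp, coneInr_coneFst, Functor.map_zero]

/-- The splitting of `Y ⟶ C_θ ⟶ Σ X` in each degree. -/
noncomputable def coneSplitting {X Y : Factorization D.ηw} (θ : X ⟶ Y) (i : ℤ) :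
    ((D.coneShortComplex θ).map (HomologicalComplex.eval _ _ i)).Splitting where
  r := D.termSnd θ (pos i)
  s := D.termInl θ (pos i)
  f_r := D.coneInr_termSnd θ (pos i)
  s_g := D.termInl_coneFst θ (pos i)
  id := D.termSnd_coneInr_add θ (pos i)

/-- The connecting morphism of the degreewise split sequence is the shift of the reduction of
`θ`. -/
lemma homOfDegreewiseSplit_coneSplitting {X Y : Factorization D.ηw} (θ : X ⟶ Y) :
    CochainComplex.homOfDegreewiseSplit _ (D.coneSplitting θ) =
      D.reduceComplexSuspension.hom.app X ≫
        (shiftFunctor (CochainComplex (FGFree D.A) ℤ) (1 : ℤ)).map (D.reduceComplex.map θ) := by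
  ext i : 1
  rw [CochainComplex.homOfDegreewiseSplit_f]
  change D.termInl θ (pos i) ≫ (D.complex (cone θ)).d i (i + 1) ≫ D.termSnd θ (pos (i + 1)) =
      ((D.termSuspension X (pos i)).hom ≫ eqToHom (congrArg (D.term X) (pos_succ i).symm)) ≫
        D.termMap θ (pos (i + 1))
  rw [complex_d]
  change D.termInl θ (pos i) ≫ (D.diff (cone θ) (pos i) ≫
    eqToHom (congrArg (D.term (cone θ)) (pos_succ i).symm)) ≫ D.termSnd θ (pos (i + 1)) = _
  rw [Category.assoc, Category.assoc, D.eqToHom_termMap θ (pos_succ i).symm,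
    D.eqToHom_termSnd θ (pos_succ i).symm, reassoc_of% (D.termInl_diff_termSnd θ (pos i))]

/-! ### The triangle of a cone in the homotopy category -/

lemma map_comp_shift_comp_commShiftIso {C C' : Type*} [Category* C] [Category* C']
    [HasShift C ℤ] [HasShift C' ℤ] (F : C ⥤ C') [F.CommShift ℤ] {Z K L : C} (a : Z ⟶ K⟦(1 : ℤ)⟧)
    (b : K ⟶ L) : F.map (a ≫ b⟦(1 : ℤ)⟧') ≫ (F.commShiftIso (1 : ℤ)).hom.app L =
      (F.map a ≫ (F.commShiftIso (1 : ℤ)).hom.app K) ≫ (F.map b)⟦(1 : ℤ)⟧' := by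
  simp

/-- Reduction modulo `w`, as a functor to the homotopy category. -/
abbrev reduceK : Factorization D.ηw ⥤ KFree D.A :=
  D.reduceComplex ⋙ HomotopyCategory.quotient _ _

/-- The isomorphism between reduction of the suspension and shift of the reduction, with the sign
for which the triangles of cones become distinguished. -/
noncomputable def reduceKSuspension :
    preSuspension D.ηw ⋙ D.reduceK ≅ D.reduceK ⋙ shiftFunctor (KFree D.A) (1 : ℤ) :=
  -(Functor.isoWhiskerRight D.reduceComplexSuspension (HomotopyCategory.quotient _ _) ≪≫
    Functor.isoWhiskerLeft D.reduceComplex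
      ((HomotopyCategory.quotient (FGFree D.A) (ComplexShape.up ℤ)).commShiftIso (1 : ℤ)))

lemma reduceKSuspension_hom_app (X : Factorization D.ηw) :
    D.reduceKSuspension.hom.app X =
      -((HomotopyCategory.quotient (FGFree D.A) (ComplexShape.up ℤ)).map
          (D.reduceComplexSuspension.hom.app X) ≫
        ((HomotopyCategory.quotient (FGFree D.A) (ComplexShape.up ℤ)).commShiftIso (1 : ℤ)).hom.app
          (D.reduceComplex.obj X)) := rfl

/-- The triangle of the cone of `θ` is distinguished because its rotation is the triangle of the
degreewise split sequence `Y ⟶ C_θ ⟶ Σ X`. -/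
lemma cone_distinguished {X Y : Factorization D.ηw} (θ : X ⟶ Y) :
    Triangle.mk (D.reduceK.map θ) (D.reduceK.map (coneInr θ))
      (D.reduceK.map (coneFst θ) ≫ D.reduceKSuspension.hom.app X) ∈
        distinguishedTriangles (C := KFree D.A) := by
  rw [rotate_distinguished_triangle]
  refine (HomotopyCategory.distinguished_iff_iso_trianglehOfDegreewiseSplit _).2
    ⟨_, D.coneSplitting θ, ⟨Iso.symm ?_⟩⟩
  refine Triangle.isoMk (CochainComplex.trianglehOfDegreewiseSplit _ (D.coneSplitting θ))
    (Triangle.mk (D.reduceK.map θ) (D.reduceK.map (coneInr θ))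
      (D.reduceK.map (coneFst θ) ≫ D.reduceKSuspension.hom.app X)).rotate
    (Iso.refl _) (Iso.refl _) (D.reduceKSuspension.app X) ?_ ?_ ?_
  · exact (Category.comp_id _).trans (Category.id_comp _).symm
  · exact (Category.id_comp _).symm
  · change ((HomotopyCategory.quotient (FGFree D.A) (ComplexShape.up ℤ)).map
        (CochainComplex.homOfDegreewiseSplit _ (D.coneSplitting θ)) ≫
      ((HomotopyCategory.quotient (FGFree D.A) (ComplexShape.up ℤ)).commShiftIso (1 : ℤ)).hom.app
        (D.reduceComplex.obj Y)) ≫ (shiftFunctor (KFree D.A) (1 : ℤ)).map (𝟙 _) =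
      D.reduceKSuspension.hom.app X ≫ (-(shiftFunctor (KFree D.A) (1 : ℤ)).map (D.reduceK.map θ))
    rw [homOfDegreewiseSplit_coneSplitting, reduceKSuspension_hom_app, Preadditive.neg_comp_neg]
    refine (congrArg _ ((shiftFunctor (KFree D.A) (1 : ℤ)).map_id _)).trans
      ((Category.comp_id _).trans ?_)
    exact map_comp_shift_comp_commShiftIso (HomotopyCategory.quotient _ _)
      (D.reduceComplexSuspension.hom.app X) (D.reduceComplex.map θ)

/-- The inclusion of `X` into the cone of its identity is sent to zero, as two consecutive
morphisms of a distinguished triangle compose to zero. -/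
lemma reduceK_map_coneInr_id (X : Factorization D.ηw) :
    D.reduceK.map (coneInr (𝟙 X)) = 0 := by
  have h := comp_distTriang_mor_zero₁₂ _ (D.cone_distinguished (𝟙 X))
  change D.reduceK.map (𝟙 X) ≫ D.reduceK.map (coneInr (𝟙 X)) = 0 at h
  rwa [CategoryTheory.Functor.map_id, Category.id_comp] at h

/-- Homotopic morphisms have the same reduction up to homotopy, as their difference factors
through the inclusion into the cone of the identity. -/
lemma reduceK_map_eq {X Y : Factorization D.ηw} {θ θ' : X ⟶ Y} (h : Homotopic D.ηw θ θ') :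
    D.reduceK.map θ = D.reduceK.map θ' := by
  obtain ⟨δ, hδ⟩ := exists_coneInr_comp_eq h
  rw [← sub_eq_zero, ← Functor.map_sub, ← hδ, Functor.map_comp, reduceK_map_coneInr_id, zero_comp]

/-! ### Acyclicity -/

section Acyclic

/-- If every factorization is exact modulo `w` at its first term, then every reduced sequence is
exact: exactness at the second term of `X` is exactness at the first term of `Σ X`. -/
lemma exists_diff_eq (hD : ∀ (X : Factorization D.ηw) (m : X.M.obj) (n : X.N.obj),
      X.f.hom m = D.w • n → ∃ (n' : X.N.obj) (e : X.M.obj),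
        m = (Twist.of D.ν X.M.obj).symm (X.g.hom n') + D.w • e)
    (X : Factorization D.ηw) (p : ℤ × Bool) (m : (D.term X (next p)).obj)
    (hm : (D.diff X (next p)).hom m = 0) : ∃ n, (D.diff X p).hom n = m := by
  obtain ⟨n, _ | _⟩ := p
  · obtain ⟨m, rfl⟩ := (Twist.of (D.νA ^ n) _).surjective m
    obtain ⟨m, rfl⟩ := Red.mk_surjective D m
    obtain ⟨a, ha⟩ := Red.mk_eq_zero.1 (show Red.mk D
      ((Twist.of D.ν X.M.obj).symm (X.g.hom m)) = 0 from hm)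
    obtain ⟨b, e, hb⟩ : ∃ (b : X.M.obj) (e : X.N.obj), m = -X.f.hom b + D.w • e :=
      hD ((preSuspension D.ηw).obj X) m (Twist.of D.ν X.M.obj (-a)) (by
        change -(X.g.hom m) = D.ν D.w • -a
        rw [D.ν_w, smul_neg, ha]
        rfl)
    refine ⟨Twist.of (D.νA ^ n) (D.Red X.M.obj) (Red.mk D (-b)), ?_⟩
    change Red.mk D (X.f.hom (-b)) = Red.mk D m
    rw [hb, map_add, Red.mk_eq_zero.2 ⟨e, rfl⟩, add_zero, map_neg]
  · obtain ⟨m, rfl⟩ := (Twist.of (D.νA ^ (n + 1)) _).surjective m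
    obtain ⟨m, rfl⟩ := Red.mk_surjective D m
    obtain ⟨a, ha⟩ := Red.mk_eq_zero.1 (show Red.mk D (X.f.hom m) = 0 from hm)
    obtain ⟨b, e, hb⟩ := hD X m a ha.symm
    refine ⟨Twist.of (D.νA ^ n) (D.Red X.N.obj) (Red.mk D b), ?_⟩
    change Red.mk D ((Twist.of D.ν X.M.obj).symm (X.g.hom b)) = Red.mk D m
    rw [hb, map_add, Red.mk_eq_zero.2 ⟨e, rfl⟩, add_zero]

lemma reduceComplex_acyclic (hD : ∀ (X : Factorization D.ηw) (m : X.M.obj) (n : X.N.obj),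
      X.f.hom m = D.w • n → ∃ (n' : X.N.obj) (e : X.M.obj),
        m = (Twist.of D.ν X.M.obj).symm (X.g.hom n') + D.w • e)
    (X : Factorization D.ηw) : acyclicFree D.A (D.reduceK.obj X) := by
  refine (acyclicFree_iff _ _).2 fun i => ?_
  obtain ⟨i, rfl⟩ : ∃ j, i = j + 1 := ⟨i - 1, by ring⟩
  rw [HomologicalComplex.exactAt_iff' _ i (i + 1) (i + 1 + 1) (by simp) (by simp),
    ShortComplex.moduleCat_exact_iff]
  intro m hm
  have key (p : ℤ × Bool) (hp : p = next (pos i)) (m : (D.term X p).obj)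
      (hm : (D.diff X p).hom m = 0) :
      ∃ n, (D.diff X (pos i) ≫ eqToHom (congrArg (D.term X) hp.symm)).hom n = m := by
    subst hp
    obtain ⟨n, hn⟩ := D.exists_diff_eq hD X _ m hm
    exact ⟨n, by simpa using hn⟩
  have key' (p : ℤ × Bool) (hp : p = next (pos (i + 1))) (m : (D.term X (pos (i + 1))).obj)
      (hm : (D.diff X (pos (i + 1)) ≫ eqToHom (congrArg (D.term X) hp.symm)).hom m = 0) :
      (D.diff X (pos (i + 1))).hom m = 0 := by
    subst hp
    simpa using hm
  have hm' : ((D.complex X).d (i + 1) (i + 1 + 1)).hom m = 0 := hm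
  rw [complex_d] at hm'
  obtain ⟨n, hn⟩ := key _ (pos_succ i) m (key' _ (pos_succ (i + 1)) m hm')
  refine ⟨n, ?_⟩
  change ((D.complex X).d i (i + 1)).hom n = m
  rw [complex_d]
  exact hn

end Acyclic

/-! ### The triangle functor -/

section TriangleFunctor

variable (hD : ∀ X : Factorization D.ηw, acyclicFree D.A (D.reduceK.obj X))

/-- Reduction modulo `w`, as a functor from factorizations to acyclic complexes. -/
abbrev reduceKac : Factorization D.ηw ⥤ Kac D.A :=
  (acyclicFree D.A).lift D.reduceK hD

/-- Reduction modulo `w`, as a functor on the homotopy category of factorizations. -/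
abbrev reduceHFact : HFact D.ηw ⥤ Kac D.A :=
  CategoryTheory.Quotient.lift _ (D.reduceKac hD) (fun _ _ _ _ h =>
    (acyclicFree D.A).hom_ext (D.reduceK_map_eq h))

lemma reduceHFact_additive : (D.reduceHFact hD).Additive where
  map_add {X Y a b} := by
    obtain ⟨a, rfl⟩ := (toHFact D.ηw).map_surjective a
    obtain ⟨b, rfl⟩ := (toHFact D.ηw).map_surjective b
    exact (acyclicFree D.A).hom_ext (D.reduceK.map_add (f := a) (g := b))

/-- The compatibility of `reduceKac` with the suspension. -/
noncomputable def reduceKacSuspension : preSuspension D.ηw ⋙ D.reduceKac hD ≅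
    D.reduceKac hD ⋙ shiftFunctor (Kac D.A) (1 : ℤ) :=
  NatIso.ofComponents (fun X => (acyclicFree D.A).isoMk
    (D.reduceKSuspension.app X ≪≫
      (((acyclicFree D.A).ι.commShiftIso (1 : ℤ)).app ((D.reduceKac hD).obj X)).symm)) (by
    intro X Y θ
    apply (acyclicFree D.A).hom_ext
    change D.reduceK.map ((preSuspension D.ηw).map θ) ≫ D.reduceKSuspension.hom.app Y ≫
        ((acyclicFree D.A).ι.commShiftIso (1 : ℤ)).inv.app ((D.reduceKac hD).obj Y) =
      (D.reduceKSuspension.hom.app X ≫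
        ((acyclicFree D.A).ι.commShiftIso (1 : ℤ)).inv.app ((D.reduceKac hD).obj X)) ≫
          (acyclicFree D.A).ι.map ((shiftFunctor (Kac D.A) (1 : ℤ)).map ((D.reduceKac hD).map θ))
    refine (Category.assoc _ _ _).symm.trans
      ((congrArg (· ≫ _) (D.reduceKSuspension.hom.naturality θ)).trans ?_)
    refine (Category.assoc _ _ _).trans (Eq.trans ?_ (Category.assoc _ _ _).symm)
    exact congrArg _ (((acyclicFree D.A).ι.commShiftIso (1 : ℤ)).inv.naturality
      ((D.reduceKac hD).map θ)))

/-- The compatibility of `reduceHFact` with the suspension. -/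
noncomputable def reduceHFactSuspension : suspension D.ηw ⋙ D.reduceHFact hD ≅
    D.reduceHFact hD ⋙ shiftFunctor (Kac D.A) (1 : ℤ) :=
  CategoryTheory.Quotient.natIsoLift _ (D.reduceKacSuspension hD)

lemma cone_distinguished_Kac {X Y : Factorization D.ηw} (θ : X ⟶ Y) :
    Triangle.mk ((D.reduceKac hD).map θ) ((D.reduceKac hD).map (coneInr θ))
      ((D.reduceKac hD).map (coneFst θ) ≫ (D.reduceKacSuspension hD).hom.app X) ∈
        distinguishedTriangles (C := Kac D.A) := by
  change (acyclicFree D.A).ι.mapTriangle.obj _ ∈ distinguishedTriangles (C := KFree D.A)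
  refine isomorphic_distinguished _ (D.cone_distinguished θ) _
    (Triangle.isoMk _ _ (Iso.refl _) (Iso.refl _) (Iso.refl _) ?_ ?_ ?_)
  · exact (Category.comp_id _).trans (Category.id_comp _).symm
  · exact (Category.comp_id _).trans (Category.id_comp _).symm
  · change ((D.reduceK.map (coneFst θ) ≫ D.reduceKSuspension.hom.app X ≫
      ((acyclicFree D.A).ι.commShiftIso (1 : ℤ)).inv.app ((D.reduceKac hD).obj X)) ≫
        ((acyclicFree D.A).ι.commShiftIso (1 : ℤ)).hom.app ((D.reduceKac hD).obj X)) ≫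
          (shiftFunctor (KFree D.A) (1 : ℤ)).map (𝟙 (D.reduceK.obj X)) =
            𝟙 _ ≫ D.reduceK.map (coneFst θ) ≫ D.reduceKSuspension.hom.app X
    have h := ((acyclicFree D.A).ι.commShiftIso (1 : ℤ)).inv_hom_id_app ((D.reduceKac hD).obj X)
    refine (congrArg _ ((shiftFunctor (KFree D.A) (1 : ℤ)).map_id _)).trans
      ((Category.comp_id _).trans (Eq.trans ?_ (Category.id_comp _).symm))
    rw [Category.assoc, Category.assoc]
    refine congrArg _ ((congrArg _ h).trans (Category.comp_id _))

/-- Reduction modulo `w`, as a triangle functor. -/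
noncomputable def triangleFunctor : TriangleFunctor D.ηw (Kac D.A) where
  T := D.reduceHFact hD
  additive := D.reduceHFact_additive hD
  suspensionIso := D.reduceHFactSuspension hD
  map_distinguished := by
    rintro X Y Z a b c ⟨X₀, Y₀, θ, e₁, e₂, e₃, h₁, h₂, h₃⟩
    refine isomorphic_distinguished _ (D.cone_distinguished_Kac hD θ) _
      (Triangle.isoMk _ _ ((D.reduceHFact hD).mapIso e₁) ((D.reduceHFact hD).mapIso e₂)
        ((D.reduceHFact hD).mapIso e₃) ?_ ?_ ?_)
    · have h := congrArg (D.reduceHFact hD).map h₁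
      rw [Functor.map_comp, Functor.map_comp] at h
      exact h
    · have h := congrArg (D.reduceHFact hD).map h₂
      rw [Functor.map_comp, Functor.map_comp] at h
      exact h
    · have h := congrArg (D.reduceHFact hD).map h₃
      rw [Functor.map_comp, Functor.map_comp] at h
      have hn := (D.reduceHFactSuspension hD).hom.naturality e₁.hom
      change ((D.reduceHFact hD).map c ≫ (D.reduceHFactSuspension hD).hom.app X) ≫
        (shiftFunctor (Kac D.A) (1 : ℤ)).map ((D.reduceHFact hD).map e₁.hom) =
          (D.reduceHFact hD).map e₃.hom ≫ (D.reduceHFact hD).map (coneπ θ) ≫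
            (D.reduceHFactSuspension hD).hom.app ((toHFact D.ηw).obj X₀)
      rw [← reassoc_of% h, Category.assoc]
      exact congrArg _ hn.symm

end TriangleFunctor

end TwistData

theorem theorem4p2 (k : Type u) [Field k] (q : k) (hq : q ≠ 0) :
    (∃ e : (QuantumCI.twistData hq).A ≃ₐ[k] QuantumCI.QCI q,
      e (Ideal.Quotient.mk _ (QuantumCI.x k)) = RingQuot.mkAlgHom k _ (QuantumCI.X k) ∧
      e (Ideal.Quotient.mk _ (QuantumCI.y k)) = RingQuot.mkAlgHom k _ (QuantumCI.Y k)) ∧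
    ∃ F : SuspendedCategory.Factorization.TriangleFunctor (QuantumCI.twistData hq).ηw
        (Kac (QuantumCI.twistData hq).A),
      Nonempty (SuspendedCategory.Factorization.toHFact (QuantumCI.twistData hq).ηw ⋙ F.T ⋙
          (acyclicFree (QuantumCI.twistData hq).A).ι ≅
        (QuantumCI.twistData hq).reduceComplex ⋙ HomotopyCategory.quotient _ _) := by
  refine ⟨⟨QuantumCI.quotientEquivQCI hq, QuantumCI.quotientEquivQCI_x hq,
    QuantumCI.quotientEquivQCI_y hq⟩, ?_⟩
  let D := QuantumCI.twistData hq
  have hD : ∀ X : SuspendedCategory.Factorization D.ηw, acyclicFree D.A (D.reduceK.obj X) := by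
    refine D.reduceComplex_acyclic fun X m n h => ?_
    have := X.M.property.1
    have := X.M.property.2
    have := X.N.property.1
    have := X.N.property.2
    refine QuantumCI.exists_eq_add_w_smul hq (f := X.f.hom.hom)
      (g := (Twist.of D.ν X.M.obj).symm.toAddMonoidHom.comp X.g.hom.hom.toAddMonoidHom)
      (fun b n => map_smul X.g.hom.hom b n) (fun m => congrArg (fun a => a.hom m) X.f_g)
      (fun n => congrArg (fun a => a.hom n) X.g_Sf) h
  exact ⟨D.triangleFunctor hD, ⟨Iso.refl _⟩⟩
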